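/- There is an absolute constant $C>0$ such that the following holds. Let $n\ge 0$ and $N\ge 1$ be integers, let $\mathcal D$ be a probability distribution on a measurable space $\mathcal X$, let $x\mapsto\rho(x)=|\psi(x)\rangle\langle\psi(x)|$ be a measurable encoding of $\mathcal X$ into pure states of $n$ qubits, let $O$ be a Hermitian $2^n\times 2^n$ matrix, $U$ a $2^n\times 2^n$ unitary, and $O^U=U^\dagger O U$. For inputs $x_1,\dots,x_N\in\mathcal X$ let $d=\dim_{\mathbb R}\mathrm{span}_{\mathbb R}\{\rho(x_1),\dots,\rho(x_N)\}$, let $K_{ij}=\mathrm{Tr}(\rho(x_i)\rho(x_j))$, and for $\lambda>0$ let $$f_\lambda(x)=\min\Bigl(1,\max\Bigl(-1,\sum_{i,j=1}^N \mathrm{Tr}(\rho(x_i)\rho(x))\,\bigl((K+\lambda I)^{-1}\bigr)_{ij}\,\mathrm{Tr}(O^U\rho(x_j))\Bigr)\Bigr)$$ be the model trained with the quantum kernel on the data $(x_i,\mathrm{Tr}(O^U\rho(x_i)))$ with regularization $\lambda$. (1) For all $x_1,\dots,x_N$, the space $\mathrm{span}_{\mathbb R}\{\rho(x_1),\dots,\rho(x_N)\}$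 has a basis $\sigma_1,\dots,\sigma_d$ that is orthonormal for the inner product $\langle A,B\rangle=\mathrm{Tr}(AB)$, and every such basis satisfies $$\sum_{p=1}^d \mathrm{Tr}(O^U\sigma_p)^2\le\min\bigl(d\,\|O\|_\infty^2,\ \|O^U\|_F^2\bigr),$$ where $\|\cdot\|_\infty$ is the spectral norm and $\|\cdot\|_F$ the Frobenius norm. (2) Suppose $\|O\|_\infty\le 1$. Then for all $x_1,\dots,x_N$ and all $x$ the limit $f^{\mathrm Q}(x)=\lim_{\lambda\to0^+}f_\lambda(x)$ exists. For every $\delta\in(0,1)$, with probability at least $1-\delta$ over $x_1,\dots,x_N$ drawn independently from $\mathcal D$, $$\mathbb E_{x\sim\mathcal D}\bigl|f^{\mathrm Q}(x)-\mathrm{Tr}(O^U\rho(x))\bigr|\le C\left(\sqrt{\frac{\min(d,\mathrm{Tr}(O^2))}{N}}+\sqrt{\frac{\log(1/\delta)}{N}}\right).$$ Moreover, with probability at least $0.99$ over $x_1,\dots,x_N$, $$\mathbb E_{x\sim\mathcal D}\bigl|f^{\mathrm Q}(x)-\mathrm{Tr}(O^U\rho(x))\bigr|\le C\sqrt{\frac{\min(d,\mathrm{Tr}(O^2))}{N}}.$$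 -/

import Mathlib

open MeasureTheory Filter Topology

noncomputable section

/-- Operators on `n` qubits, as `2^n × 2^n` complex matrices. -/
abbrev QOp (n : ℕ) : Type := Matrix (Fin (2 ^ n)) (Fin (2 ^ n)) ℂ

/-- `ρ = |ψ⟩⟨ψ|` for some unit vector `ψ`. -/
def IsPureState {n : ℕ} (ρ : QOp n) : Prop :=
  ∃ ψ : Fin (2 ^ n) → ℂ, star ψ ⬝ᵥ ψ = 1 ∧ ρ = Matrix.vecMulVec ψ (star ψ)

/-- The spectral norm: the operator norm for the Euclidean norm on `ℂ^(2^n)`. -/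
def specNorm {n : ℕ} (A : QOp n) : ℝ :=
  ‖Matrix.toEuclideanCLM (𝕜 := ℂ) A‖

/-- The squared Frobenius norm. -/
def frobSq {n : ℕ} (A : QOp n) : ℝ :=
  ∑ i, ∑ j, ‖A i j‖ ^ 2

/-- The Heisenberg evolved observable `O^U = U† O U`. -/
def heisenberg {n : ℕ} (U : Matrix.unitaryGroup (Fin (2 ^ n)) ℂ) (O : QOp n) : QOp n :=
  (U : QOp n).conjTranspose * O * (U : QOp n)

/-- `Tr(A ρ)`, which is real for Hermitian `A` and `ρ`. -/
def trInner {n : ℕ} (A B : QOp n) : ℝ :=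
  (Matrix.trace (A * B)).re

/-- The real subspace `span {ρ(x_1), …, ρ(x_N)}` spanned by the training states. -/
def trainSpan {n : ℕ} {X : Type*} (ρ : X → QOp n) {N : ℕ} (xs : Fin N → X) :
    Submodule ℝ (QOp n) :=
  Submodule.span ℝ (Set.range fun i => ρ (xs i))

/-- The dimension `d` of the span of the training states. -/
def trainDim {n : ℕ} {X : Type*} (ρ : X → QOp n) {N : ℕ} (xs : Fin N → X) : ℕ :=
  Module.finrank ℝ (trainSpan ρ xs)

/-- `σ_1, …, σ_d` is an orthonormal basis of the real subspace `S` of matrices for the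
inner product `⟨A, B⟩ = Tr(A B)`. -/
def IsTraceONB {n d : ℕ} (S : Submodule ℝ (QOp n)) (σ : Fin d → QOp n) : Prop :=
  (∀ p q, Matrix.trace (σ p * σ q) = if p = q then 1 else 0) ∧
    Submodule.span ℝ (Set.range σ) = S

/-- The quantum kernel `k(x, x') = Tr(ρ(x) ρ(x'))`. -/
def quantumKernel {n : ℕ} {X : Type*} (ρ : X → QOp n) (x x' : X) : ℝ :=
  trInner (ρ x) (ρ x')

/-- The model trained with kernel `k` and regularization `lam` on the data `(x_i, y_i)`:
`x ↦ min(1, max(-1, ∑ i j, k(x_i, x) ((K + lam I)⁻¹)_{ij} y_j))` with `K_{ij} = k(x_i, x_j)`. -/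
def regularizedModel {X : Type*} {N : ℕ} (k : X → X → ℝ) (xs : Fin N → X) (ys : Fin N → ℝ)
    (lam : ℝ) (x : X) : ℝ :=
  min 1 (max (-1) (∑ i, ∑ j, k (xs i) x *
    ((Matrix.of (fun a b => k (xs a) (xs b)) + lam • (1 : Matrix (Fin N) (Fin N) ℝ))⁻¹ i j) *
      ys j))

/-- The trained model without regularization: the pointwise limit of the regularized models as
`lam → 0⁺` (also meaningful for a singular Gram matrix, e.g. with repeated inputs). -/
def trainedModel {X : Type*} {N : ℕ} (k : X → X → ℝ) (xs : Fin N → X) (ys : Fin N → ℝ)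
    (x : X) : ℝ :=
  limUnder (𝓝[>] (0 : ℝ)) (fun lam => regularizedModel k xs ys lam x)

/-- The quantum kernel model `f^Q`, trained on `(x_i, Tr(O^U ρ(x_i)))`; here `A = O^U`. -/
def quantumModel {n : ℕ} {X : Type*} {N : ℕ} (ρ : X → QOp n) (A : QOp n) (xs : Fin N → X) :
    X → ℝ :=
  trainedModel (quantumKernel ρ) xs (fun i => trInner A (ρ (xs i)))

/-- The expected prediction error `E_{x ∼ D} |f(x) - Tr(A ρ(x))|` exists and is at most `b`. -/
def PredErrorLE {n : ℕ} {X : Type*} [MeasurableSpace X] (D : Measure X) (ρ : X → QOp n)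
    (A : QOp n) (f : X → ℝ) (b : ℝ) : Prop :=
  Integrable (fun x => |f x - trInner A (ρ x)|) D ∧
    ∫ x, |f x - trInner A (ρ x)| ∂D ≤ b

end

/-! In the real Hilbert space of matrices with inner product Re Tr(A†B), pure states are unit
vectors and the kernel is a Gram kernel. As λ → 0⁺, ridge regression converges to the orthogonal
projection w of A = O^U onto the span of the training states (`tendsto_ridge`). So f^Q is a
truncated linear predictor that interpolates the data, and its error is controlled by ‖w‖ alone.

Two bounds on ‖w‖² produce the minimum. Projections contract, so ‖w‖² ≤ Tr(O²). Moreover d of the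
training states already span, and their state vectors span a complex subspace of dimension at most
d. If P projects onto it, then Tr(AB) = Tr(APB) for B in the span, so (AP)† represents the
functional, with squared Frobenius norm at most d‖A‖∞² (`exists_representer`). The same representers
and Bessel's inequality give part (1).

For predictors of norm at most B, symmetrization, contraction and the Rademacher complexity B√N give
a uniform deviation bound (`measure_exists_clippedLoss_deviation_le`). Since ‖w‖ depends on the
sample, a union bound over integer bounds k on ‖w‖², with failure probability δ2⁻ᵏ each, makes it
adaptive (`measure_exists_interpolating_le`).

At fixed confidence the extra term is absorbed because d ≥ 1 when Tr(O²) ≥ 1. When Tr(O²) < 1,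
rescaling the observable by its Frobenius norm shrinks the confidence term by the same factor
(`measure_not_predErrorLE_le`). -/

/-! ### Rademacher averages: concentration and contraction -/

/-- The sign `±1` of a Boolean. -/
def boolSign (b : Bool) : ℝ := if b then 1 else -1

/-- The expectation of `F` over independent uniformly distributed signs. -/
noncomputable def radE : (N : ℕ) → ((Fin N → Bool) → ℝ) → ℝ
  | 0, F => F Fin.elim0
  | N + 1, F => (radE N (fun s => F (Fin.cons true s)) + radE N (fun s => F (Fin.cons false s))) / 2

@[simp] lemma boolSign_true : boolSign true = 1 := rfl

@[simp] lemma boolSign_false : boolSign false = -1 := rfl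

lemma boolSign_not (b : Bool) : boolSign (!b) = -boolSign b := by cases b <;> simp

lemma radE_mono {N : ℕ} {F G : (Fin N → Bool) → ℝ} (h : ∀ s, F s ≤ G s) :
    radE N F ≤ radE N G := by
  induction N with
  | zero => exact h _
  | succ N ih =>
    have h1 := ih (F := fun s => F (Fin.cons true s)) (G := fun s => G (Fin.cons true s))
      fun s => h _
    have h2 := ih (F := fun s => F (Fin.cons false s)) (G := fun s => G (Fin.cons false s))
      fun s => h _
    simp only [radE]
    linarith

lemma radE_const (N : ℕ) (c : ℝ) : radE N (fun _ => c) = c := by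
  induction N with
  | zero => rfl
  | succ N ih => simp only [radE, ih]; ring

lemma radE_add {N : ℕ} (F G : (Fin N → Bool) → ℝ) :
    radE N (fun s => F s + G s) = radE N F + radE N G := by
  induction N with
  | zero => rfl
  | succ N ih =>
    simp only [radE]
    rw [ih (fun s => F (Fin.cons true s)), ih (fun s => F (Fin.cons false s))]
    ring

lemma radE_const_mul {N : ℕ} (c : ℝ) (F : (Fin N → Bool) → ℝ) :
    radE N (fun s => c * F s) = c * radE N F := by
  induction N with
  | zero => rfl
  | succ N ih =>
    simp only [radE]
    rw [ih (fun s => F (Fin.cons true s)), ih (fun s => F (Fin.cons false s))]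
    ring

lemma radE_not {N : ℕ} (F : (Fin N → Bool) → ℝ) :
    radE N (fun s => F (fun i => !(s i))) = radE N F := by
  induction N with
  | zero => exact congrArg F (Subsingleton.elim _ _)
  | succ N ih =>
    have key : ∀ (b : Bool) (s : Fin N → Bool),
        (fun i => !((Fin.cons b s : Fin (N + 1) → Bool) i)) =
          (Fin.cons (!b) (fun i => !(s i)) : Fin (N + 1) → Bool) := by
      intro b s
      funext i
      refine Fin.cases ?_ (fun j => ?_) i <;> simp
    simp only [radE, key, Bool.not_true, Bool.not_false]
    rw [ih (fun s => F (Fin.cons false s)), ih (fun s => F (Fin.cons true s)), add_comm]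

lemma sq_radE_le {N : ℕ} (F : (Fin N → Bool) → ℝ) :
    radE N F ^ 2 ≤ radE N (fun s => F s ^ 2) := by
  induction N with
  | zero => exact le_rfl
  | succ N ih =>
    have h1 := ih (fun s => F (Fin.cons true s))
    have h2 := ih (fun s => F (Fin.cons false s))
    simp only [radE]
    nlinarith [sq_nonneg (radE N (fun s => F (Fin.cons true s)) -
      radE N (fun s => F (Fin.cons false s)))]

lemma integral_radE {Ω : Type*} [MeasurableSpace Ω] {μ : Measure Ω} {N : ℕ}
    (f : (Fin N → Bool) → Ω → ℝ) (hf : ∀ s, Integrable (f s) μ) :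
    Integrable (fun z => radE N (fun s => f s z)) μ ∧
      ∫ z, radE N (fun s => f s z) ∂μ = radE N (fun s => ∫ z, f s z ∂μ) := by
  induction N with
  | zero => exact ⟨hf _, rfl⟩
  | succ N ih =>
    obtain ⟨i1, e1⟩ := ih (fun s => f (Fin.cons true s)) fun s => hf _
    obtain ⟨i2, e2⟩ := ih (fun s => f (Fin.cons false s)) fun s => hf _
    simp only [radE]
    refine ⟨(i1.add i2).div_const 2, ?_⟩
    rw [integral_div, integral_add i1 i2, e1, e2]

/-- Bounded differences inequality for the moment generating function on the cube. -/
lemma radE_exp_le {N : ℕ} {c : ℝ} (F : (Fin N → Bool) → ℝ)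
    (hF : ∀ s t i, (∀ j, j ≠ i → s j = t j) → F s - F t ≤ c) :
    radE N (fun s => Real.exp (F s)) ≤ Real.exp (radE N F + N * (c ^ 2 / 8)) := by
  induction N with
  | zero => simp [radE]
  | succ N ih =>
    have hd : ∀ (b : Bool) (s t : Fin N → Bool) (i : Fin N), (∀ j, j ≠ i → s j = t j) →
        F (Fin.cons b s) - F (Fin.cons b t) ≤ c := by
      intro b s t i h
      refine hF _ _ i.succ fun j => ?_
      refine Fin.cases (fun _ => by simp) (fun k hk => ?_) j
      simpa using h k fun e => hk (by rw [e])
    have h1 := ih (fun s => F (Fin.cons true s)) (hd true)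
    have h2 := ih (fun s => F (Fin.cons false s)) (hd false)
    have hflip : ∀ (b b' : Bool),
        radE N (fun s => F (Fin.cons b s)) ≤ radE N (fun s => F (Fin.cons b' s)) + c := by
      intro b b'
      rw [← radE_const N c, ← radE_add]
      refine radE_mono fun s => ?_
      have := hF (Fin.cons b s) (Fin.cons b' s) 0 (fun j => by
        refine Fin.cases (fun h => absurd rfl h) (fun k _ => by simp) j)
      linarith
    have d1 := hflip true false
    have d2 := hflip false true
    simp only [radE]
    set p := radE N (fun s => F (Fin.cons true s))
    set q := radE N (fun s => F (Fin.cons false s))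
    -- Given the first sign, the conditional means `p` and `q` differ by at most `c`. Hoeffding's
    -- bound for this two-point variable costs c²/8 per coordinate.
    have hcosh : Real.cosh ((p - q) / 2) ≤ Real.exp (c ^ 2 / 8) := by
      refine (Real.cosh_le_exp_half_sq _).trans (Real.exp_le_exp.2 ?_)
      have : (p - q) ^ 2 ≤ c ^ 2 := by
        refine sq_le_sq' (by linarith) (by linarith)
      linarith
    calc _ ≤ (Real.exp (p + N * (c ^ 2 / 8)) + Real.exp (q + N * (c ^ 2 / 8))) / 2 := by linarith
      _ = Real.exp ((p + q) / 2 + N * (c ^ 2 / 8)) * Real.cosh ((p - q) / 2) := by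
        have e1 : p + N * (c ^ 2 / 8) = (p + q) / 2 + N * (c ^ 2 / 8) + (p - q) / 2 := by ring
        have e2 : q + N * (c ^ 2 / 8) = (p + q) / 2 + N * (c ^ 2 / 8) + -((p - q) / 2) := by ring
        rw [e1, e2, Real.exp_add _ ((p - q) / 2), Real.exp_add _ (-((p - q) / 2)), Real.cosh_eq]
        ring
      _ ≤ Real.exp ((p + q) / 2 + N * (c ^ 2 / 8)) * Real.exp (c ^ 2 / 8) := by gcongr
      _ = _ := by
        rw [← Real.exp_add]
        push_cast
        ring_nf

/-- The contraction principle for Rademacher averages. -/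
lemma radE_sup'_contraction {ι : Type*} {T : Finset ι} (hT : T.Nonempty) {N : ℕ} (a : ι → ℝ)
    (h : Fin N → ι → ℝ) (φ : Fin N → ℝ → ℝ) (hφ : ∀ i x y, |φ i x - φ i y| ≤ |x - y|) :
    radE N (fun s => T.sup' hT fun w => a w + ∑ i, boolSign (s i) * φ i (h i w)) ≤
      radE N (fun s => T.sup' hT fun w => a w + ∑ i, boolSign (s i) * h i w) := by
  induction N generalizing a with
  | zero => exact le_rfl
  | succ N ih =>
    simp only [radE, Fin.sum_univ_succ, Fin.cons_zero, Fin.cons_succ, boolSign_true,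
      boolSign_false, one_mul, neg_mul, ← add_assoc]
    -- The term of the first sign is absorbed into the offset `a`, which is why the induction
    -- generalizes over it.
    have h1 := ih (fun w => a w + φ 0 (h 0 w)) (fun i => h i.succ) (fun i => φ i.succ)
      fun i => hφ i.succ
    have h2 := ih (fun w => a w + -φ 0 (h 0 w)) (fun i => h i.succ) (fun i => φ i.succ)
      fun i => hφ i.succ
    have h3 : ∀ b : ι → ℝ,
        (T.sup' hT fun w => b w + φ 0 (h 0 w)) + (T.sup' hT fun w => b w - φ 0 (h 0 w)) ≤
          (T.sup' hT fun w => b w + h 0 w) + (T.sup' hT fun w => b w - h 0 w) := by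
      intro b
      obtain ⟨w, hw, ew⟩ := T.exists_mem_eq_sup' hT fun w => b w + φ 0 (h 0 w)
      obtain ⟨u, hu, eu⟩ := T.exists_mem_eq_sup' hT fun w => b w - φ 0 (h 0 w)
      rw [ew, eu]
      have l1 := T.le_sup' (fun w => b w + h 0 w) hw
      have l2 := T.le_sup' (fun w => b w + h 0 w) hu
      have l3 := T.le_sup' (fun w => b w - h 0 w) hw
      have l4 := T.le_sup' (fun w => b w - h 0 w) hu
      -- With maximizers `w` and `u` of the two left suprema, the sign of `h 0 w - h 0 u` decides
      -- which of them to test in which right supremum.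
      have l5 := (le_abs_self _).trans (hφ 0 (h 0 w) (h 0 u))
      rcases abs_cases (h 0 w - h 0 u) with ⟨e, _⟩ | ⟨e, _⟩ <;> rw [e] at l5 <;> linarith
    have h4 : radE N (fun s => (T.sup' hT fun w =>
          a w + φ 0 (h 0 w) + ∑ i : Fin N, boolSign (s i) * h i.succ w) +
        (T.sup' hT fun w => a w + -φ 0 (h 0 w) + ∑ i : Fin N, boolSign (s i) * h i.succ w)) ≤
        radE N (fun s => (T.sup' hT fun w =>
          a w + h 0 w + ∑ i : Fin N, boolSign (s i) * h i.succ w) +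
        (T.sup' hT fun w => a w + -h 0 w + ∑ i : Fin N, boolSign (s i) * h i.succ w)) := by
      refine radE_mono fun s => ?_
      have := h3 fun w => a w + ∑ i : Fin N, boolSign (s i) * h i.succ w
      simp only [sub_eq_add_neg] at this
      simpa only [add_right_comm] using this
    rw [radE_add, radE_add] at h4
    linarith

/-! ### Rademacher complexity of linear functionals -/

section Hilbert

variable {E : Type*} [NormedAddCommGroup E] [InnerProductSpace ℝ E]

lemma radE_norm_sq {N : ℕ} (u : E) (v : Fin N → E) :
    radE N (fun s => ‖u + ∑ i, boolSign (s i) • v i‖ ^ 2) = ‖u‖ ^ 2 + ∑ i, ‖v i‖ ^ 2 := by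
  induction N generalizing u with
  | zero => simp [radE]
  | succ N ih =>
    simp only [radE, Fin.sum_univ_succ, Fin.cons_zero, Fin.cons_succ, boolSign_true,
      boolSign_false, one_smul, neg_smul, ← add_assoc]
    rw [ih (u + v 0), ih (u + -v 0), ← sub_eq_add_neg, norm_add_sq_real, norm_sub_sq_real]
    ring

/-- The Rademacher complexity of the functionals `⟪w, ·⟫` with `‖w‖ ≤ B` on unit vectors. -/
lemma radE_sup'_inner_le {ι : Type*} {T : Finset ι} (hT : T.Nonempty) {N : ℕ} {B : ℝ}
    (hB : 0 ≤ B) (w : ι → E) (hw : ∀ k, ‖w k‖ ≤ B) (v : Fin N → E) (hv : ∀ i, ‖v i‖ ≤ 1) :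
    radE N (fun s => T.sup' hT fun k => ∑ i, boolSign (s i) * inner ℝ (w k) (v i)) ≤
      B * √N := by
  have h1 : radE N (fun s => T.sup' hT fun k => ∑ i, boolSign (s i) * inner ℝ (w k) (v i)) ≤
      radE N (fun s => B * ‖∑ i, boolSign (s i) • v i‖) := by
    refine radE_mono fun s => Finset.sup'_le _ _ fun k _ => ?_
    have : ∑ i, boolSign (s i) * inner ℝ (w k) (v i) =
        inner ℝ (w k) (∑ i, boolSign (s i) • v i) := by
      simp [inner_sum, inner_smul_right]
    rw [this]
    exact (real_inner_le_norm _ _).trans (by gcongr; exact hw k)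
  -- After Cauchy–Schwarz, only the mean norm of a signed sum remains. By Jensen it is at most the
  -- root of the second moment, where the cross terms cancel.
  rw [radE_const_mul] at h1
  refine h1.trans (mul_le_mul_of_nonneg_left (Real.le_sqrt_of_sq_le ?_) hB)
  refine (sq_radE_le _).trans ?_
  have h2 := radE_norm_sq (0 : E) v
  simp only [zero_add] at h2
  rw [h2]
  calc _ ≤ (0 : ℝ) + ∑ _i : Fin N, (1 : ℝ) := by
        simp only [norm_zero]
        refine add_le_add (by norm_num) (Finset.sum_le_sum fun i _ => ?_)
        exact pow_le_one₀ (norm_nonneg _) (hv i)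
    _ = N := by simp

end Hilbert

lemma MeasureTheory.MeasurePreserving.integral_comp_of_measurable {α β : Type*}
    [MeasurableSpace α] [MeasurableSpace β] {μ : Measure α} {ν : Measure β} {f : α → β}
    (hf : MeasurePreserving f μ ν) {G : β → ℝ} (hG : Measurable G) :
    ∫ x, G (f x) ∂μ = ∫ y, G y ∂ν := by
  rw [← hf.map_eq, integral_map hf.aemeasurable hG.aestronglyMeasurable]

lemma integrable_of_measurable_bounded {α : Type*} [MeasurableSpace α] {μ : Measure α}
    [IsFiniteMeasure μ] {f : α → ℝ} (hf : Measurable f) {c : ℝ} (h : ∀ x, |f x| ≤ c) :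
    Integrable f μ :=
  Integrable.of_bound hf.aestronglyMeasurable c (.of_forall h)

/-! ### Symmetrization and uniform deviation for finite classes -/

section Symmetrization

variable {X ι : Type*} {T : Finset ι} {N : ℕ}

/-- The supremum over `T` of the signed differences of `g` along pairs of samples. -/
def signedSup (hT : T.Nonempty) (g : ι → X → ℝ) (s : Fin N → Bool) (z : Fin N → X × X) : ℝ :=
  T.sup' hT fun k => ∑ i, boolSign (s i) * (g k (z i).2 - g k (z i).1)

lemma abs_sup'_le (hT : T.Nonempty) {f : ι → ℝ} {c : ℝ} (hf : ∀ k, |f k| ≤ c) :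
    |T.sup' hT f| ≤ c := by
  obtain ⟨k, _, e⟩ := T.exists_mem_eq_sup' hT f
  rw [e]
  exact hf k

lemma abs_sum_fin_le {f : Fin N → ℝ} {c : ℝ} (hf : ∀ i, |f i| ≤ c) : |∑ i, f i| ≤ N * c := by
  refine (Finset.abs_sum_le_sum_abs _ _).trans ((Finset.sum_le_sum fun i _ => hf i).trans ?_)
  simp

lemma abs_boolSign (b : Bool) : |boolSign b| = 1 := by cases b <;> simp

variable {g : ι → X → ℝ} (hg0 : ∀ k x, 0 ≤ g k x) (hg2 : ∀ k x, g k x ≤ 2)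

include hg0 hg2 in
lemma abs_signedSup_le (hT : T.Nonempty) (s : Fin N → Bool) (z : Fin N → X × X) :
    |signedSup hT g s z| ≤ N * 2 := by
  refine abs_sup'_le hT fun k => abs_sum_fin_le fun i => ?_
  rw [abs_mul, abs_boolSign, one_mul, abs_le]
  constructor <;> linarith [hg0 k (z i).1, hg2 k (z i).1, hg0 k (z i).2, hg2 k (z i).2]

include hg0 hg2 in
lemma radE_exp_sup'_le (hT : T.Nonempty) {R t : ℝ} (ht : 0 ≤ t) (xs : Fin N → X)
    (hR : radE N (fun s => T.sup' hT fun k => ∑ i, boolSign (s i) * g k (xs i)) ≤ R) :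
    radE N (fun s => Real.exp (2 * t * T.sup' hT fun k => ∑ i, boolSign (s i) * g k (xs i))) ≤
      Real.exp (2 * t * R + 8 * t ^ 2 * N) := by
  -- Flipping one sign moves the supremum by at most 2·2 = 4, and the factor 2t makes this 8t; then
  -- c²/8 = 8t².
  refine (radE_exp_le (c := 8 * t) _ fun s s' j h => ?_).trans ?_
  · have : (T.sup' hT fun k => ∑ i, boolSign (s i) * g k (xs i)) ≤
        (T.sup' hT fun k => ∑ i, boolSign (s' i) * g k (xs i)) + 4 := by
      refine Finset.sup'_le _ _ fun k hk => ?_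
      have h1 := T.le_sup' (fun k => ∑ i, boolSign (s' i) * g k (xs i)) hk
      have h2 : ∑ i, boolSign (s i) * g k (xs i) - ∑ i, boolSign (s' i) * g k (xs i) =
          (boolSign (s j) - boolSign (s' j)) * g k (xs j) := by
        rw [← Finset.sum_sub_distrib, Finset.sum_eq_single j]
        · ring
        · intro i _ hi
          rw [h i hi, sub_self]
        · simp
      have h3 : (boolSign (s j) - boolSign (s' j)) * g k (xs j) ≤ 4 := by
        have := hg0 k (xs j)
        have := hg2 k (xs j)
        cases s j <;> cases s' j <;> simp <;> linarith
      linarith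
    nlinarith
  · rw [radE_const_mul]
    refine Real.exp_le_exp.2 ?_
    have := mul_le_mul_of_nonneg_left hR (by positivity : 0 ≤ 2 * t)
    linarith

include hg0 hg2 in
-- The supremum of differences is at most the sum of a supremum over each half of the pairs, the
-- first half with negated signs. AM–GM on the exponentials decouples the halves at the price of
-- doubling `t`, and negating all signs does not change the average.
lemma radE_exp_signedSup_le (hT : T.Nonempty) {R t : ℝ} (ht : 0 ≤ t)
    (hR : ∀ xs : Fin N → X,
      radE N (fun s => T.sup' hT fun k => ∑ i, boolSign (s i) * g k (xs i)) ≤ R)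
    (z : Fin N → X × X) :
    radE N (fun s => Real.exp (t * signedSup hT g s z)) ≤
      Real.exp (2 * t * R + 8 * t ^ 2 * N) := by
  set A : (Fin N → X) → (Fin N → Bool) → ℝ := fun xs s =>
    T.sup' hT fun k => ∑ i, boolSign (s i) * g k (xs i) with hA
  have h1 : ∀ s, Real.exp (t * signedSup hT g s z) ≤
      2⁻¹ * (Real.exp (2 * t * A (fun i => (z i).2) s) +
        Real.exp (2 * t * A (fun i => (z i).1) fun i => !(s i))) := by
    intro s
    have h2 : signedSup hT g s z ≤
        A (fun i => (z i).2) s + A (fun i => (z i).1) fun i => !(s i) := by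
      refine Finset.sup'_le _ _ fun k hk => ?_
      have l1 := T.le_sup' (fun k => ∑ i, boolSign (s i) * g k (z i).2) hk
      have l2 := T.le_sup' (fun k => ∑ i, boolSign (!(s i)) * g k (z i).1) hk
      refine le_trans (le_of_eq ?_) (add_le_add l1 l2)
      rw [← Finset.sum_add_distrib]
      refine Finset.sum_congr rfl fun i _ => ?_
      rw [boolSign_not]
      ring
    set a := A (fun i => (z i).2) s
    set b := A (fun i => (z i).1) fun i => !(s i)
    have h3 : Real.exp (t * signedSup hT g s z) ≤ Real.exp (t * a) * Real.exp (t * b) := by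
      rw [← Real.exp_add]
      refine Real.exp_le_exp.2 ?_
      have := mul_le_mul_of_nonneg_left h2 ht
      linarith
    have e1 : Real.exp (2 * t * a) = Real.exp (t * a) ^ 2 := by
      rw [← Real.exp_nat_mul]; push_cast; ring_nf
    have e2 : Real.exp (2 * t * b) = Real.exp (t * b) ^ 2 := by
      rw [← Real.exp_nat_mul]; push_cast; ring_nf
    rw [e1, e2]
    nlinarith [sq_nonneg (Real.exp (t * a) - Real.exp (t * b))]
  refine (radE_mono h1).trans ?_
  rw [radE_const_mul, radE_add,
    radE_not (fun s => Real.exp (2 * t * A (fun i => (z i).1) s))]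
  have l1 := radE_exp_sup'_le hg0 hg2 hT ht _ (hR fun i => (z i).2)
  have l2 := radE_exp_sup'_le hg0 hg2 hT ht _ (hR fun i => (z i).1)
  linarith

variable [MeasurableSpace X] (hgm : ∀ k, Measurable (g k))

include hgm in
lemma measurable_signedSup (hT : T.Nonempty)
    (s : Fin N → Bool) : Measurable (signedSup hT g s) := by
  have : signedSup hT g s = T.sup' hT fun k (z : Fin N → X × X) =>
      ∑ i, boolSign (s i) * (g k (z i).2 - g k (z i).1) := by
    funext z
    simp [signedSup, Finset.sup'_apply]
  rw [this]
  refine Finset.measurable_sup' hT fun k _ => ?_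
  refine Finset.measurable_sum _ fun i _ => Measurable.const_mul ?_ _
  exact ((hgm k).comp (measurable_snd.comp (measurable_pi_apply i))).sub
    ((hgm k).comp (measurable_fst.comp (measurable_pi_apply i)))

variable (D : Measure X)

/-- The supremum over `T` of `N` times the difference of the expectation and the empirical mean. -/
noncomputable def deviationSup (hT : T.Nonempty) (g : ι → X → ℝ) (xs : Fin N → X) : ℝ :=
  T.sup' hT fun k => ∑ i, ((∫ x, g k x ∂D) - g k (xs i))

include hgm in
lemma measurable_deviationSup (hT : T.Nonempty) :
    Measurable (deviationSup D hT g : (Fin N → X) → ℝ) := by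
  have : (deviationSup D hT g : (Fin N → X) → ℝ) = T.sup' hT fun k (xs : Fin N → X) =>
      ∑ i, ((∫ x, g k x ∂D) - g k (xs i)) := by
    funext xs
    simp [deviationSup, Finset.sup'_apply]
  rw [this]
  refine Finset.measurable_sup' hT fun k _ => Finset.measurable_sum _ fun i _ => ?_
  exact measurable_const.sub ((hgm k).comp (measurable_pi_apply i))

variable [IsProbabilityMeasure D]

include hg0 hg2 hgm in
lemma integrable_exp_signedSup (hT : T.Nonempty) (t : ℝ) (s : Fin N → Bool) :
    Integrable (fun z => Real.exp (t * signedSup hT g s z))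
      (Measure.pi fun _ : Fin N => D.prod D) := by
  refine integrable_of_measurable_bounded (c := Real.exp (|t| * (N * 2)))
    ((measurable_signedSup hgm hT s).const_mul t).exp fun z => ?_
  rw [Real.abs_exp]
  refine Real.exp_le_exp.2 ((le_abs_self _).trans ?_)
  rw [abs_mul]
  exact mul_le_mul_of_nonneg_left (abs_signedSup_le hg0 hg2 hT s z) (abs_nonneg t)

include hg0 hg2 hgm in
-- Exchanging the two members of a pair flips its sign and preserves the product measure. The
-- integral is therefore the same for every sign pattern and may be replaced by its Rademacher
-- average.
lemma integral_exp_signedSup_le (hT : T.Nonempty) {R t : ℝ} (ht : 0 ≤ t)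
    (hR : ∀ xs : Fin N → X,
      radE N (fun s => T.sup' hT fun k => ∑ i, boolSign (s i) * g k (xs i)) ≤ R) :
    ∫ z, Real.exp (t * signedSup hT g (fun _ => true) z) ∂(Measure.pi fun _ : Fin N => D.prod D) ≤
      Real.exp (2 * t * R + 8 * t ^ 2 * N) := by
  set P := Measure.pi fun _ : Fin N => D.prod D
  have hswap : ∀ s : Fin N → Bool, ∫ z, Real.exp (t * signedSup hT g s z) ∂P =
      ∫ z, Real.exp (t * signedSup hT g (fun _ => true) z) ∂P := by
    intro s
    have hmp : MeasurePreserving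
        (fun (z : Fin N → X × X) i => (if s i then id else Prod.swap) (z i)) P P := by
      refine measurePreserving_pi _ _ fun i => ?_
      cases s i
      · exact Measure.measurePreserving_swap
      · exact MeasurePreserving.id _
    rw [← hmp.integral_comp_of_measurable
      ((measurable_signedSup hgm hT fun _ => true).const_mul t).exp]
    refine integral_congr_ae (.of_forall fun z => ?_)
    have : ∀ k i, boolSign (s i) * (g k (z i).2 - g k (z i).1) =
        boolSign true * (g k ((if s i then id else Prod.swap) (z i)).2 -
          g k ((if s i then id else Prod.swap) (z i)).1) := by
      intro k i
      cases s i <;> simp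
    simp only [signedSup, this]
  obtain ⟨hi, he⟩ := integral_radE (μ := P) (fun s z => Real.exp (t * signedSup hT g s z))
    fun s => integrable_exp_signedSup hg0 hg2 hgm D hT t s
  simp only [hswap, radE_const] at he
  rw [← he]
  refine (integral_mono hi (integrable_const _)
    (radE_exp_signedSup_le hg0 hg2 hT ht hR)).trans ?_
  simp [P]

include hg0 hg2 hgm in
lemma integral_loss_mem (k : ι) : 0 ≤ ∫ x, g k x ∂D ∧ ∫ x, g k x ∂D ≤ 2 := by
  refine ⟨integral_nonneg (hg0 k), ?_⟩
  refine (integral_mono (integrable_of_measurable_bounded (c := 2) (hgm k) fun x => ?_)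
    (integrable_const 2) (hg2 k)).trans (by simp)
  rw [abs_of_nonneg (hg0 k x)]
  exact hg2 k x

include hg0 hg2 hgm in
lemma abs_deviationSup_le (hT : T.Nonempty) (xs : Fin N → X) :
    |deviationSup D hT g xs| ≤ N * 2 := by
  refine abs_sup'_le hT fun k => abs_sum_fin_le fun i => ?_
  have := integral_loss_mem hg0 hg2 hgm D k
  rw [abs_le]
  constructor <;> linarith [hg0 k (xs i), hg2 k (xs i)]

include hg0 hg2 hgm in
lemma integrable_exp_deviationSup (hT : T.Nonempty) (t : ℝ) :
    Integrable (fun xs => Real.exp (t * deviationSup D hT g xs))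
      (Measure.pi fun _ : Fin N => D) := by
  refine integrable_of_measurable_bounded (c := Real.exp (|t| * (N * 2)))
    ((measurable_deviationSup hgm D hT).const_mul t).exp fun z => ?_
  rw [Real.abs_exp]
  refine Real.exp_le_exp.2 ((le_abs_self _).trans ?_)
  rw [abs_mul]
  exact mul_le_mul_of_nonneg_left (abs_deviationSup_le hg0 hg2 hgm D hT z) (abs_nonneg t)

include hg0 hg2 hgm in
/-- Symmetrization with a ghost sample. -/
lemma integral_exp_deviationSup_le_signedSup (hT : T.Nonempty) {t : ℝ} (ht : 0 ≤ t) :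
    ∫ xs, Real.exp (t * deviationSup D hT g xs) ∂(Measure.pi fun _ : Fin N => D) ≤
      ∫ z, Real.exp (t * signedSup hT g (fun _ => true) z)
        ∂(Measure.pi fun _ : Fin N => D.prod D) := by
  set Q := Measure.pi fun _ : Fin N => D
  let Φ : (Fin N → X) × (Fin N → X) → ℝ := fun p =>
    Real.exp (t * signedSup hT g (fun _ => true) fun i => (p.1 i, p.2 i))
  have hzip : Measurable fun p : (Fin N → X) × (Fin N → X) => fun i => (p.1 i, p.2 i) :=
    measurable_pi_lambda _ fun i => ((measurable_pi_apply i).comp measurable_fst).prodMk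
      ((measurable_pi_apply i).comp measurable_snd)
  have hΦm : Measurable Φ :=
    (((measurable_signedSup hgm hT fun _ => true).comp hzip).const_mul t).exp
  have hΦb : ∀ p, |Φ p| ≤ Real.exp (t * (N * 2)) := fun p => by
    rw [Real.abs_exp]
    exact Real.exp_le_exp.2 (mul_le_mul_of_nonneg_left
      ((le_abs_self _).trans (abs_signedSup_le hg0 hg2 hT _ _)) ht)
  have hΦi : Integrable Φ (Q.prod Q) := integrable_of_measurable_bounded hΦm hΦb
  have e1 : ∫ z, Real.exp (t * signedSup hT g (fun _ => true) z)
      ∂(Measure.pi fun _ : Fin N => D.prod D) = ∫ p, Φ p ∂(Q.prod Q) :=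
    (measurePreserving_arrowProdEquivProdArrow X X (Fin N) (fun _ => D)
      fun _ => D).integral_comp_of_measurable hΦm
  rw [e1, integral_prod _ hΦi]
  refine integral_mono (integrable_exp_deviationSup hg0 hg2 hgm D hT t) hΦi.integral_prod_left
    fun xs => ?_
  -- For fixed `xs` the maximizer `k` is frozen, so the deviation becomes an integral over the ghost
  -- sample and Jensen applies to the exponential. Bounding by the supremum comes last.
  obtain ⟨k, hk, e⟩ := T.exists_mem_eq_sup' hT
    fun k => ∑ i : Fin N, ((∫ x, g k x ∂D) - g k (xs i))
  have hmk : ∀ i, Measurable fun ys : Fin N → X => g k (ys i) := fun i =>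
    (hgm k).comp (measurable_pi_apply i)
  have hik : ∀ i, Integrable (fun ys : Fin N → X => g k (ys i)) Q := fun i =>
    integrable_of_measurable_bounded (c := 2) (hmk i) fun ys => by
      rw [abs_of_nonneg (hg0 _ _)]; exact hg2 _ _
  have hsum : Measurable fun ys : Fin N → X => t * ∑ i, (g k (ys i) - g k (xs i)) :=
    (Finset.measurable_sum _ fun i _ => (hmk i).sub_const _).const_mul t
  have hsb : ∀ ys : Fin N → X, |t * ∑ i, (g k (ys i) - g k (xs i))| ≤ t * (N * 2) := fun ys => by
    rw [abs_mul, abs_of_nonneg ht]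
    refine mul_le_mul_of_nonneg_left (abs_sum_fin_le fun i => ?_) ht
    rw [abs_le]
    constructor <;> linarith [hg0 k (xs i), hg2 k (xs i), hg0 k (ys i), hg2 k (ys i)]
  have e2 : t * deviationSup D hT g xs = ∫ ys, t * ∑ i, (g k (ys i) - g k (xs i)) ∂Q := by
    rw [deviationSup, e, integral_const_mul]
    have e3 := integral_finsetSum (μ := Q) Finset.univ
      (f := fun (i : Fin N) (ys : Fin N → X) => g k (ys i) - g k (xs i)) fun i _ =>
      (hik i).sub (integrable_const _)
    rw [e3]
    congr 1
    refine Finset.sum_congr rfl fun i _ => ?_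
    rw [integral_sub (hik i) (integrable_const _),
      integral_comp_eval (μ := fun _ : Fin N => D) (hgm k).aestronglyMeasurable]
    simp [Q]
  have hei : Integrable (fun ys : Fin N → X => Real.exp (t * ∑ i, (g k (ys i) - g k (xs i)))) Q :=
    integrable_of_measurable_bounded hsum.exp fun ys => by
      rw [Real.abs_exp]
      exact Real.exp_le_exp.2 ((le_abs_self _).trans (hsb ys))
  simp only
  rw [e2]
  refine (convexOn_exp.map_integral_le Real.continuous_exp.continuousOn isClosed_univ
    (.of_forall fun _ => Set.mem_univ _) (integrable_of_measurable_bounded hsum hsb)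
    hei).trans ?_
  refine integral_mono hei (integrable_of_measurable_bounded
    (hΦm.comp measurable_prodMk_left) fun ys => hΦb (xs, ys)) fun ys => ?_
  refine Real.exp_le_exp.2 (mul_le_mul_of_nonneg_left ?_ ht)
  refine le_trans (le_of_eq ?_) (T.le_sup' _ hk)
  simp

include hg0 hg2 hgm in
/-- Uniform deviation bound for a finite class of `[0, 2]`-valued functions. -/
lemma measure_exists_deviation_le (hT : T.Nonempty) (hN : 0 < N) {R u : ℝ} (hu : 0 ≤ u)
    (hR : ∀ xs : Fin N → X,
      radE N (fun s => T.sup' hT fun k => ∑ i, boolSign (s i) * g k (xs i)) ≤ R) :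
    (Measure.pi fun _ : Fin N => D)
        {xs | ∃ k ∈ T, 2 * R + u < ∑ i, ((∫ x, g k x ∂D) - g k (xs i))} ≤
      ENNReal.ofReal (Real.exp (-(u ^ 2 / (32 * N)))) := by
  have hN' : (0 : ℝ) < N := Nat.cast_pos.2 hN
  -- The minimizer of -tu + 8t²N, with minimum -u²/(32N).
  set t : ℝ := u / (16 * N) with ht
  have ht0 : 0 ≤ t := by positivity
  set Q := Measure.pi fun _ : Fin N => D
  have hsub : {xs : Fin N → X | ∃ k ∈ T, 2 * R + u < ∑ i, ((∫ x, g k x ∂D) - g k (xs i))} ⊆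
      {xs | 2 * R + u ≤ deviationSup D hT g xs} := by
    rintro xs ⟨k, hk, h⟩
    exact h.le.trans (T.le_sup' (fun k => ∑ i, ((∫ x, g k x ∂D) - g k (xs i))) hk)
  refine (measure_mono hsub).trans ?_
  rw [← ofReal_measureReal (measure_ne_top _ _)]
  refine ENNReal.ofReal_le_ofReal ?_
  refine (ProbabilityTheory.measure_ge_le_exp_mul_mgf (2 * R + u) ht0
    (integrable_exp_deviationSup hg0 hg2 hgm D hT t)).trans ?_
  have h1 : ProbabilityTheory.mgf (deviationSup D hT g) Q t ≤
      Real.exp (2 * t * R + 8 * t ^ 2 * N) :=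
    (integral_exp_deviationSup_le_signedSup hg0 hg2 hgm D hT ht0).trans
      (integral_exp_signedSup_le hg0 hg2 hgm D hT ht0 hR)
  refine (mul_le_mul_of_nonneg_left h1 (Real.exp_pos _).le).trans (le_of_eq ?_)
  rw [← Real.exp_add, ht]
  congr 1
  field_simp
  ring

end Symmetrization

/-! ### Truncated linear predictors and adaptivity to the norm -/

/-- Truncation of a real number to `[-1, 1]`. -/
def clip (t : ℝ) : ℝ := min 1 (max (-1) t)

lemma abs_clip_le (t : ℝ) : |clip t| ≤ 1 :=
  abs_le.2 ⟨le_min (by norm_num) (le_max_left _ _), min_le_left _ _⟩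

lemma clip_of_abs_le {t : ℝ} (h : |t| ≤ 1) : clip t = t := by
  rw [abs_le] at h
  rw [clip, max_eq_right h.1, min_eq_right h.2]

lemma abs_clip_sub_clip_le (a b : ℝ) : |clip a - clip b| ≤ |a - b| := by
  refine (abs_min_sub_min_le_max _ _ _ _).trans ?_
  rw [sub_self, abs_zero]
  refine max_le (abs_nonneg _) ((abs_max_sub_max_le_max _ _ _ _).trans ?_)
  rw [sub_self, abs_zero]
  exact max_le (abs_nonneg _) le_rfl

lemma continuous_clip : Continuous clip := by unfold clip; fun_prop

section UniformBound

variable {X E : Type*} [NormedAddCommGroup E] [InnerProductSpace ℝ E]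

/-- The absolute loss of the truncated linear predictor `w` against the target `f`. -/
def clippedLoss (v : X → E) (f : X → ℝ) (w : E) (x : X) : ℝ :=
  |clip (inner ℝ w (v x)) - f x|

lemma clippedLoss_nonneg (v : X → E) (f : X → ℝ) (w : E) (x : X) : 0 ≤ clippedLoss v f w x :=
  abs_nonneg _

variable {v : X → E} {f : X → ℝ}

lemma clippedLoss_le (hf : ∀ x, |f x| ≤ 1) (w : E) (x : X) : clippedLoss v f w x ≤ 2 := by
  refine (abs_sub _ _).trans ?_
  linarith [abs_clip_le (inner ℝ w (v x)), hf x]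

lemma continuous_clippedLoss (x : X) : Continuous fun w => clippedLoss v f w x := by
  unfold clippedLoss
  have := continuous_clip
  fun_prop

lemma radE_sup'_clippedLoss_le {ι : Type*} {T : Finset ι} (hT : T.Nonempty) {N : ℕ} {B : ℝ}
    (hB : 0 ≤ B) (hv : ∀ x, ‖v x‖ ≤ 1) (w : ι → E) (hw : ∀ k, ‖w k‖ ≤ B) (xs : Fin N → X) :
    radE N (fun s => T.sup' hT fun k => ∑ i, boolSign (s i) * clippedLoss v f (w k) (xs i)) ≤
      B * √N := by
  have h := radE_sup'_contraction hT (fun _ => 0) (fun i k => inner ℝ (w k) (v (xs i)))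
    (fun i t => |clip t - f (xs i)|) fun i a b => by
      refine (abs_abs_sub_abs_le_abs_sub _ _).trans ?_
      rw [sub_sub_sub_cancel_right]
      exact abs_clip_sub_clip_le a b
  simp only [zero_add] at h
  exact h.trans (radE_sup'_inner_le hT hB w hw _ fun i => hv _)

variable [MeasurableSpace X]

lemma measurable_clippedLoss (hvm : ∀ w : E, Measurable fun x => inner ℝ w (v x))
    (hfm : Measurable f) (w : E) : Measurable (clippedLoss v f w) :=
  ((continuous_clip.measurable.comp (hvm w)).sub hfm).abs

variable (D : Measure X) [IsProbabilityMeasure D] {N : ℕ}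

lemma integrable_clippedLoss (hvm : ∀ w : E, Measurable fun x => inner ℝ w (v x))
    (hfm : Measurable f) (hf : ∀ x, |f x| ≤ 1) (w : E) : Integrable (clippedLoss v f w) D :=
  integrable_of_measurable_bounded (c := 2) (measurable_clippedLoss hvm hfm w) fun x => by
    rw [abs_of_nonneg (clippedLoss_nonneg v f w x)]
    exact clippedLoss_le hf w x

variable [FiniteDimensional ℝ E]

/-- Uniform deviation bound for the truncated linear predictors of norm at most `B`. -/
lemma measure_exists_clippedLoss_deviation_le
    (hv : ∀ x, ‖v x‖ ≤ 1) (hvm : ∀ w : E, Measurable fun x => inner ℝ w (v x))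
    (hfm : Measurable f) (hf : ∀ x, |f x| ≤ 1) (hN : 0 < N) {B u : ℝ} (hB : 0 ≤ B) (hu : 0 ≤ u) :
    (Measure.pi fun _ : Fin N => D)
        {xs | ∃ w : E, ‖w‖ ≤ B ∧ 2 * (B * √N) + u <
          ∑ i, ((∫ x, clippedLoss v f w x ∂D) - clippedLoss v f w (xs i))} ≤
      ENNReal.ofReal (Real.exp (-(u ^ 2 / (32 * N)))) := by
  have : Nonempty (Metric.closedBall (0 : E) B) := ⟨⟨0, by simpa using hB⟩⟩
  -- Finite initial segments of a dense sequence reduce the ball to finite classes. A strict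
  -- deviation is an open condition on the predictor, so the increasing events `S n` cover the whole
  -- event, with the same bound for each.
  let w : ℕ → E := fun n => (TopologicalSpace.denseSeq (Metric.closedBall (0 : E) B) n : E)
  have hw : ∀ n, ‖w n‖ ≤ B := fun n => 
    mem_closedBall_zero_iff.1 (TopologicalSpace.denseSeq (Metric.closedBall (0 : E) B) n).2
  let S : ℕ → Set (Fin N → X) := fun n =>
    {xs | ∃ k ∈ Finset.range (n + 1), 2 * (B * √N) + u <
      ∑ i, ((∫ x, clippedLoss v f (w k) x ∂D) - clippedLoss v f (w k) (xs i))}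
  have hS : Monotone S := by
    rintro m n hmn xs ⟨k, hk, h⟩
    exact ⟨k, Finset.range_mono (by omega) hk, h⟩
  have hint : Continuous fun w : E => ∫ x, clippedLoss v f w x ∂D := by
    refine continuous_of_dominated (bound := fun _ => 2)
      (fun w => (measurable_clippedLoss hvm hfm w).aestronglyMeasurable)
      (fun w => .of_forall fun x => ?_) (integrable_const _)
      (.of_forall fun x => continuous_clippedLoss x)
    rw [Real.norm_eq_abs, abs_of_nonneg (clippedLoss_nonneg v f w x)]
    exact clippedLoss_le hf w x
  have hsub : {xs : Fin N → X | ∃ w : E, ‖w‖ ≤ B ∧ 2 * (B * √N) + u <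
      ∑ i, ((∫ x, clippedLoss v f w x ∂D) - clippedLoss v f w (xs i))} ⊆ ⋃ n, S n := by
    rintro xs ⟨w₀, hw₀, h⟩
    have hcont : Continuous fun w : Metric.closedBall (0 : E) B =>
        ∑ i, ((∫ x, clippedLoss v f w x ∂D) - clippedLoss v f (w : E) (xs i)) :=
      continuous_finsetSum _ fun i _ => (hint.comp continuous_subtype_val).sub
        ((continuous_clippedLoss (xs i)).comp continuous_subtype_val)
    obtain ⟨n, hn⟩ := (TopologicalSpace.denseRange_denseSeq
      (Metric.closedBall (0 : E) B)).exists_mem_open (isOpen_Ioi.preimage hcont)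
      ⟨⟨w₀, by simpa using hw₀⟩, h⟩
    exact Set.mem_iUnion.2 ⟨n, n, by simp, hn⟩
  refine (measure_mono hsub).trans ?_
  rw [hS.measure_iUnion]
  refine iSup_le fun n => ?_
  exact measure_exists_deviation_le (g := fun k => clippedLoss v f (w k))
    (fun k x => clippedLoss_nonneg v f (w k) x) (fun k x => clippedLoss_le hf (w k) x)
    (fun k => measurable_clippedLoss hvm hfm (w k)) D (T := Finset.range (n + 1)) (by simp) hN hu
    fun xs => radE_sup'_clippedLoss_le _ hB hv w hw xs

/-- With probability at least `1 - δ`, all linear predictors that interpolate the training data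
generalize, with a bound that depends on their norm. -/
lemma measure_exists_interpolating_le
    (hv : ∀ x, ‖v x‖ ≤ 1) (hvm : ∀ w : E, Measurable fun x => inner ℝ w (v x))
    (hfm : Measurable f) (hf : ∀ x, |f x| ≤ 1) (hN : 0 < N) {δ : ℝ} (hδ : 0 < δ) (hδ1 : δ < 1) :
    (Measure.pi fun _ : Fin N => D)
        {xs | ∃ (w : E) (k : ℕ), 0 < k ∧ ‖w‖ ^ 2 ≤ k ∧
          (∀ i, inner ℝ w (v (xs i)) = f (xs i)) ∧
          8 * (√(k / N) + √(Real.log (1 / δ) / N)) < ∫ x, clippedLoss v f w x ∂D} ≤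
      ENNReal.ofReal δ := by
  have hN' : (0 : ℝ) < N := Nat.cast_pos.2 hN
  set L := Real.log (1 / δ) with hL
  have hL0 : 0 ≤ L := Real.log_nonneg (by rw [le_div_iff₀ hδ]; linarith)
  -- Chosen so that exp(-u²/(32N)) = δ2⁻ᵏ.
  let u : ℕ → ℝ := fun k => √(32 * N * (L + k * Real.log 2))
  have hlog2 : 0 < Real.log 2 := Real.log_pos (by norm_num)
  have hsub : {xs : Fin N → X | ∃ (w : E) (k : ℕ), 0 < k ∧ ‖w‖ ^ 2 ≤ k ∧
      (∀ i, inner ℝ w (v (xs i)) = f (xs i)) ∧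
      8 * (√(k / N) + √(L / N)) < ∫ x, clippedLoss v f w x ∂D} ⊆
      ⋃ j : ℕ, {xs | ∃ w : E, ‖w‖ ≤ √((j + 1 : ℕ) : ℝ) ∧ 2 * (√((j + 1 : ℕ) : ℝ) * √N) + u (j + 1) <
          ∑ i, ((∫ x, clippedLoss v f w x ∂D) - clippedLoss v f w (xs i))} := by
    rintro xs ⟨w, k, hk, hwk, hi, h⟩
    obtain ⟨j, rfl⟩ : ∃ j, k = j + 1 := ⟨k - 1, by omega⟩
    refine Set.mem_iUnion.2 ⟨j, w, Real.le_sqrt_of_sq_le hwk, ?_⟩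
    -- Interpolation makes the empirical loss vanish: the targets lie in [-1, 1], so truncation
    -- leaves them unchanged.
    have h0 : ∀ i, clippedLoss v f w (xs i) = 0 := fun i => by
      rw [clippedLoss, hi i, clip_of_abs_le (hf _), sub_self, abs_zero]
    simp only [h0, sub_zero, Finset.sum_const, Finset.card_univ, Fintype.card_fin, nsmul_eq_mul]
    generalize hκ : ((j + 1 : ℕ) : ℝ) = κ at *
    have hκ0 : 0 ≤ κ := by rw [← hκ]; positivity
    have hκN : √κ * √N = N * √(κ / N) := by
      rw [Real.sqrt_div hκ0]
      field_simp
      rw [Real.sq_sqrt hN'.le]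
    have hLN : √(L * N) = N * √(L / N) := by
      rw [Real.sqrt_div hL0, Real.sqrt_mul hL0]
      field_simp
      rw [Real.sq_sqrt hN'.le]
    -- Uses 32 ≤ 6² and log 2 ≤ 1. With the 2 from symmetrization this yields the constant 8.
    have hu : u (j + 1) ≤ 6 * (√κ * √N) + 6 * √(L * N) := by
      refine Real.sqrt_le_iff.2 ⟨by positivity, ?_⟩
      have e1 : (√κ * √N) ^ 2 = κ * N := by
        rw [mul_pow, Real.sq_sqrt hκ0, Real.sq_sqrt hN'.le]
      have e2 : √(L * N) ^ 2 = L * N := Real.sq_sqrt (by positivity)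
      have e3 : 0 ≤ (√κ * √N) * √(L * N) := by positivity
      have e4 : κ * N * Real.log 2 ≤ κ * N * 1 := by
        gcongr
        linarith [Real.log_two_lt_d9]
      have e5 : 0 ≤ L * N := by positivity
      have e6 : 0 ≤ κ * N := by positivity
      rw [hκ]
      nlinarith
    have := mul_lt_mul_of_pos_left h hN'
    rw [hκN] at hu ⊢
    rw [hLN] at hu
    have : 0 ≤ N * √(L / N) := by positivity
    linarith
  refine (measure_mono hsub).trans ((measure_iUnion_le _).trans ?_)
  have hk : ∀ j : ℕ, Real.exp (-(u (j + 1) ^ 2 / (32 * N))) = δ * (1 / 2 / 2 ^ j) := by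
    intro j
    have : u (j + 1) ^ 2 / (32 * N) = L + (j + 1 : ℕ) * Real.log 2 := by
      simp only [u]
      rw [Real.sq_sqrt (by positivity)]
      field_simp
    rw [this, neg_add, Real.exp_add, hL, one_div, Real.log_inv, neg_neg, Real.exp_log hδ,
      Real.exp_neg, Real.exp_nat_mul, Real.exp_log (by norm_num)]
    rw [pow_succ]
    field_simp
  calc
    _ ≤ ∑' j : ℕ, ENNReal.ofReal (δ * (1 / 2 / 2 ^ j)) := by
        refine ENNReal.tsum_le_tsum fun j => ?_
        rw [← hk j]
        exact measure_exists_clippedLoss_deviation_le D hv hvm hfm hf hN (Real.sqrt_nonneg _)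
          (Real.sqrt_nonneg _)
    _ = ENNReal.ofReal δ := by
        have hs : HasSum (fun j : ℕ => δ * (1 / 2 / 2 ^ j)) (δ * 1) :=
          (hasSum_geometric_two' 1).mul_left δ
        rw [← ENNReal.ofReal_tsum_of_nonneg (fun j => by positivity) hs.summable, hs.tsum_eq,
          mul_one]

end UniformBound

/-! ### The limit of ridge regression without regularization -/

section Ridge

variable {E : Type*} [NormedAddCommGroup E] [InnerProductSpace ℝ E] {N : ℕ}

/-- The ridge regression solution tends to the orthogonal projection of the target. -/
lemma tendsto_ridge [FiniteDimensional ℝ E] (v : Fin N → E) (A z : E) :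
    Tendsto (fun lam : ℝ => ∑ i, ∑ j, inner ℝ (v i) z *
        ((Matrix.of (fun a b => inner ℝ (v a) (v b)) +
          lam • (1 : Matrix (Fin N) (Fin N) ℝ))⁻¹ i j) * inner ℝ A (v j))
      (𝓝[>] 0) (𝓝 (inner ℝ ((Submodule.span ℝ (Set.range v)).starProjection A) z)) := by
  set S := Submodule.span ℝ (Set.range v) with hS
  -- Any coefficient vector of the projection will do; it need not be unique, so the Gram matrix may
  -- be singular.
  obtain ⟨b, hb⟩ : ∃ b : Fin N → ℝ, ∑ i, b i • v i = S.starProjection A :=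
    (Submodule.mem_span_range_iff_exists_fun ℝ).1 (S.starProjection_apply_mem A)
  set K : Matrix (Fin N) (Fin N) ℝ := Matrix.of (fun a b => inner ℝ (v a) (v b)) with hK
  have hpd : ∀ lam : ℝ, 0 < lam → (K + lam • (1 : Matrix (Fin N) (Fin N) ℝ)).PosDef := by
    intro lam hl
    have h1 : K.PosSemidef := Matrix.posSemidef_gram ℝ v
    exact Matrix.PosDef.posSemidef_add h1 (Matrix.PosDef.one.smul hl)
  set c : ℝ → Fin N → ℝ := fun lam =>
    (K + lam • (1 : Matrix (Fin N) (Fin N) ℝ))⁻¹.mulVec fun j => inner ℝ A (v j) with hc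
  have hKT : ∀ (a : Fin N → ℝ) i, K.mulVec a i = inner ℝ (v i) (∑ j, a j • v j) := by
    intro a i
    simp [hK, Matrix.mulVec, dotProduct, inner_sum, inner_smul_right, mul_comm]
  have hAv : ∀ j, inner ℝ A (v j) = inner ℝ (v j) (∑ i, b i • v i) := by
    intro j
    rw [hb, real_inner_comm, ← sub_eq_zero, ← inner_sub_right]
    rw [real_inner_comm]
    exact S.starProjection_inner_eq_zero A (v j) (Submodule.subset_span ⟨j, rfl⟩)
  -- For e = c - b the normal equations read Ke + λe = -λb. Pairing with e gives ‖∑ eᵢvᵢ‖² = -λ⟨e, b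
  -- + e⟩ ≤ λ‖b‖².
  have key : ∀ lam : ℝ, 0 < lam →
      ‖∑ i, c lam i • v i - S.starProjection A‖ ^ 2 ≤ lam * ∑ i, b i ^ 2 := by
    intro lam hl
    set e : Fin N → ℝ := c lam - b with he
    have hsys : (K + lam • (1 : Matrix (Fin N) (Fin N) ℝ)).mulVec (c lam) =
        fun j => inner ℝ A (v j) := by
      rw [hc, Matrix.mulVec_mulVec, Matrix.mul_nonsing_inv _
        ((Matrix.isUnit_iff_isUnit_det _).1 (hpd lam hl).isUnit), Matrix.one_mulVec]
    have hTe : ∑ i, e i • v i = ∑ i, c lam i • v i - S.starProjection A := by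
      rw [← hb, ← Finset.sum_sub_distrib]
      exact Finset.sum_congr rfl fun i _ => by rw [he, Pi.sub_apply, sub_smul]
    have hi : ∀ i, inner ℝ (v i) (∑ j, e j • v j) + lam * e i = -lam * b i := by
      intro i
      have h1 := congrFun hsys i
      rw [Matrix.add_mulVec, Pi.add_apply, hKT, Matrix.smul_mulVec, Matrix.one_mulVec,
        Pi.smul_apply, smul_eq_mul, hAv] at h1
      rw [hTe, ← hb, inner_sub_right, he, Pi.sub_apply]
      linarith
    rw [← hTe, ← real_inner_self_eq_norm_sq]
    have h2 : inner ℝ (∑ i, e i • v i) (∑ i, e i • v i) =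
        ∑ i, e i * (-lam * b i - lam * e i) := by
      rw [sum_inner]
      refine Finset.sum_congr rfl fun i _ => ?_
      rw [real_inner_smul_left, ← hi i]
      ring
    rw [h2, Finset.mul_sum]
    refine Finset.sum_le_sum fun i _ => ?_
    nlinarith [sq_nonneg (e i + b i), sq_nonneg (e i), sq_nonneg (b i),
      mul_nonneg hl.le (sq_nonneg (e i + b i)), mul_nonneg hl.le (sq_nonneg (e i)),
      mul_nonneg hl.le (sq_nonneg (b i))]
  have hlim : Tendsto (fun lam => ∑ i, c lam i • v i) (𝓝[>] 0) (𝓝 (S.starProjection A)) := by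
    rw [tendsto_iff_norm_sub_tendsto_zero]
    have h0 : Tendsto (fun lam : ℝ => √(lam * ∑ i, b i ^ 2)) (𝓝[>] 0) (𝓝 0) := by
      have : Continuous fun lam : ℝ => √(lam * ∑ i, b i ^ 2) := by fun_prop
      simpa using (this.tendsto 0).mono_left nhdsWithin_le_nhds
    refine squeeze_zero' (.of_forall fun _ => norm_nonneg _) ?_ h0
    filter_upwards [self_mem_nhdsWithin] with lam hl
    exact Real.le_sqrt_of_sq_le (key lam hl)
  have := hlim.inner (tendsto_const_nhds (x := z)) (𝕜 := ℝ)
  refine this.congr fun lam => ?_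
  rw [sum_inner]
  refine Finset.sum_congr rfl fun i _ => ?_
  rw [real_inner_smul_left, hc]
  simp only [Matrix.mulVec, dotProduct, Finset.sum_mul]
  exact Finset.sum_congr rfl fun j _ => by ring

end Ridge

/-! ### Matrices as a real Hilbert space; pure states and norms -/

section Operators

variable {n : ℕ}

/-- The matrices with entries listed as a vector, with the Euclidean norm. -/
abbrev QVec (n : ℕ) : Type := PiLp 2 fun _ : Fin (2 ^ n) × Fin (2 ^ n) => ℂ

/-- The list of entries of a matrix. -/
def opVec : QOp n ≃ₗ[ℝ] QVec n where
  toFun A := WithLp.toLp 2 fun p => A p.1 p.2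
  invFun w := Matrix.of fun i j => w (i, j)
  map_add' _ _ := rfl
  map_smul' _ _ := rfl
  left_inv _ := rfl
  right_inv _ := rfl

lemma opVec_apply (A : QOp n) (p : Fin (2 ^ n) × Fin (2 ^ n)) : opVec A p = A p.1 p.2 := rfl

lemma inner_opVec (A B : QOp n) :
    inner ℝ (opVec A) (opVec B) = (Matrix.trace (A.conjTranspose * B)).re := by
  rw [PiLp.inner_apply, Fintype.sum_prod_type_right]
  simp [opVec_apply, Matrix.trace, Matrix.mul_apply, Complex.inner, mul_comm]

lemma norm_sq_opVec (A : QOp n) : ‖opVec A‖ ^ 2 = frobSq A := by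
  rw [PiLp.norm_sq_eq_of_L2, Fintype.sum_prod_type]
  rfl

lemma Matrix.IsHermitian.inner_opVec {A : QOp n} (hA : A.IsHermitian) (B : QOp n) :
    inner ℝ (opVec A) (opVec B) = trInner A B := by
  rw [_root_.inner_opVec, hA.eq, trInner]

lemma IsPureState.isHermitian {ρ : QOp n} (h : IsPureState ρ) : ρ.IsHermitian := by
  obtain ⟨ψ, _, rfl⟩ := h
  rw [Matrix.IsHermitian, Matrix.conjTranspose_vecMulVec, star_star]

lemma trace_mul_vecMulVec_star (A : QOp n) (ψ : Fin (2 ^ n) → ℂ) :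
    Matrix.trace (A * Matrix.vecMulVec ψ (star ψ)) = star ψ ⬝ᵥ A.mulVec ψ := by
  rw [Matrix.mul_vecMulVec, Matrix.trace_vecMulVec, dotProduct_comm]

lemma IsPureState.norm_opVec {ρ : QOp n} (h : IsPureState ρ) : ‖opVec ρ‖ = 1 := by
  have h1 : ‖opVec ρ‖ ^ 2 = 1 := by
    rw [← real_inner_self_eq_norm_sq, h.isHermitian.inner_opVec, trInner]
    obtain ⟨ψ, hψ, rfl⟩ := h
    rw [trace_mul_vecMulVec_star, Matrix.vecMulVec_mulVec, hψ]
    simp [hψ]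
  exact (pow_eq_one_iff_of_nonneg (norm_nonneg _) two_ne_zero).1 h1

lemma norm_toLp_sq_eq {m : Type*} [Fintype m] (ψ : m → ℂ) :
    ‖(WithLp.toLp 2 ψ : EuclideanSpace ℂ m)‖ ^ 2 = (star ψ ⬝ᵥ ψ).re := by
  rw [EuclideanSpace.norm_sq_eq]
  simp [dotProduct, Complex.sq_norm, Complex.normSq_apply]

lemma norm_toLp_mulVec_le (A : QOp n) (ψ : Fin (2 ^ n) → ℂ) :
    ‖(WithLp.toLp 2 (A.mulVec ψ) : EuclideanSpace ℂ (Fin (2 ^ n)))‖ ≤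
      specNorm A * ‖(WithLp.toLp 2 ψ : EuclideanSpace ℂ (Fin (2 ^ n)))‖ :=
  (Matrix.toEuclideanCLM (𝕜 := ℂ) A).le_opNorm (WithLp.toLp 2 ψ)

/-- Tr(A|ψ⟩⟨ψ|) = ⟨ψ, Aψ⟩ with ‖ψ‖ = 1. -/
lemma IsPureState.abs_trInner_le {ρ : QOp n} (h : IsPureState ρ) (A : QOp n) :
    |trInner A ρ| ≤ specNorm A := by
  obtain ⟨ψ, hψ, rfl⟩ := h
  have h1 : ‖(WithLp.toLp 2 ψ : EuclideanSpace ℂ (Fin (2 ^ n)))‖ = 1 := by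
    have : ‖(WithLp.toLp 2 ψ : EuclideanSpace ℂ (Fin (2 ^ n)))‖ ^ 2 = 1 := by
      rw [norm_toLp_sq_eq, hψ, Complex.one_re]
    exact (pow_eq_one_iff_of_nonneg (norm_nonneg _) two_ne_zero).1 this
  have h2 := norm_inner_le_norm (𝕜 := ℂ) (WithLp.toLp 2 ψ : EuclideanSpace ℂ (Fin (2 ^ n)))
    (WithLp.toLp 2 (A.mulVec ψ))
  have h3 := norm_toLp_mulVec_le A ψ
  rw [EuclideanSpace.inner_toLp_toLp, dotProduct_comm] at h2
  rw [trInner, trace_mul_vecMulVec_star]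
  refine (Complex.abs_re_le_norm _).trans (h2.trans ?_)
  rw [h1] at h3 ⊢
  linarith

lemma heisenberg_isHermitian {O : QOp n} (hO : O.IsHermitian)
    (U : Matrix.unitaryGroup (Fin (2 ^ n)) ℂ) : (heisenberg U O).IsHermitian :=
  Matrix.isHermitian_conjTranspose_mul_mul _ hO

lemma specNorm_heisenberg_le (U : Matrix.unitaryGroup (Fin (2 ^ n)) ℂ) (O : QOp n) :
    specNorm (heisenberg U O) ≤ specNorm O := by
  have hU : Matrix.toEuclideanCLM (𝕜 := ℂ) (U : QOp n) ∈ unitary _ :=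
    Unitary.map_mem (Matrix.toEuclideanCLM (𝕜 := ℂ) (n := Fin (2 ^ n))) U.2
  have h1 : Matrix.toEuclideanCLM (𝕜 := ℂ) (heisenberg U O) =
      star (Matrix.toEuclideanCLM (𝕜 := ℂ) (U : QOp n)) * Matrix.toEuclideanCLM (𝕜 := ℂ) O *
        Matrix.toEuclideanCLM (𝕜 := ℂ) (U : QOp n) := by
    rw [heisenberg, map_mul, map_mul, ← Matrix.star_eq_conjTranspose, map_star]
  rw [specNorm, h1, CStarRing.norm_mul_mem_unitary _ hU,
    CStarRing.norm_mem_unitary_mul _ (Unitary.star_mem hU)]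
  exact le_rfl

lemma trInner_heisenberg_self (U : Matrix.unitaryGroup (Fin (2 ^ n)) ℂ) (O : QOp n) :
    trInner (heisenberg U O) (heisenberg U O) = trInner O O := by
  have hU : (U : QOp n) * (U : QOp n).conjTranspose = 1 := Unitary.mul_star_self_of_mem U.2
  have h1 : heisenberg U O * heisenberg U O = (U : QOp n).conjTranspose * (O * O * (U : QOp n)) := by
    simp only [heisenberg, Matrix.mul_assoc]
    rw [← Matrix.mul_assoc (U : QOp n) (U : QOp n).conjTranspose, hU, Matrix.one_mul]
  rw [trInner, h1, Matrix.trace_mul_comm, Matrix.mul_assoc, hU, Matrix.mul_one, trInner]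

end Operators

/-! ### Geometry of the span of the training states -/

section TrainingSpan

variable {n N : ℕ} {X : Type*} {ρ : X → QOp n}

lemma isHermitian_of_mem_trainSpan (hρ : ∀ x, IsPureState (ρ x)) (xs : Fin N → X) {B : QOp n}
    (hB : B ∈ trainSpan ρ xs) : B.IsHermitian := by
  refine Submodule.span_induction ?_ Matrix.isHermitian_zero (fun _ _ _ _ => .add) ?_ hB
  · rintro _ ⟨i, rfl⟩
    exact (hρ _).isHermitian
  · intro a B _ hB
    exact hB.smul (by simp [IsSelfAdjoint])

lemma map_opVec_trainSpan (ρ : X → QOp n) (xs : Fin N → X) :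
    (trainSpan ρ xs).map (opVec (n := n)).toLinearMap =
      Submodule.span ℝ (Set.range fun i => opVec (ρ (xs i))) := by
  rw [trainSpan, Submodule.map_span, ← Set.range_comp]
  rfl

lemma im_trace_mul_eq_zero {A B : QOp n} (hA : A.IsHermitian) (hB : B.IsHermitian) :
    (Matrix.trace (A * B)).im = 0 := by
  have h : star (Matrix.trace (A * B)) = Matrix.trace (A * B) := by
    rw [← Matrix.trace_conjTranspose, Matrix.conjTranspose_mul, hA.eq, hB.eq,
      Matrix.trace_mul_comm]
  exact Complex.conj_eq_iff_im.1 h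

/-- The span consists of Hermitian matrices, on which Tr(AB) is real and agrees with the Frobenius
inner product, so an orthonormal basis can be transported back from `QVec n`. -/
lemma exists_isTraceONB (hρ : ∀ x, IsPureState (ρ x)) (xs : Fin N → X) :
    ∃ σ : Fin (trainDim ρ xs) → QOp n, IsTraceONB (trainSpan ρ xs) σ := by
  set S' := (trainSpan ρ xs).map (opVec (n := n)).toLinearMap with hS'
  have hd : Module.finrank ℝ S' = trainDim ρ xs := LinearEquiv.finrank_map_eq opVec _
  let b := (stdOrthonormalBasis ℝ S').reindex (finCongr hd)
  have hmem : ∀ p, opVec.symm (b p : QVec n) ∈ trainSpan ρ xs := fun p => by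
    obtain ⟨B, hB, e⟩ := (b p).2
    rw [← e]
    simpa using hB
  have hherm := fun p => isHermitian_of_mem_trainSpan hρ xs (hmem p)
  refine ⟨fun p => opVec.symm (b p : QVec n), fun p q => ?_, ?_⟩
  · refine Complex.ext ?_ ?_
    · have h1 := (hherm p).inner_opVec (opVec.symm (b q : QVec n))
      rw [LinearEquiv.apply_symm_apply, LinearEquiv.apply_symm_apply, trInner] at h1
      have h2 := orthonormal_iff_ite.1 b.orthonormal p q
      rw [Submodule.coe_inner] at h2
      rw [← h1, h2]
      split_ifs <;> simp
    · rw [im_trace_mul_eq_zero (hherm p) (hherm q)]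
      split_ifs <;> simp
  · have h1 : Submodule.span ℝ (Set.range fun p => (b p : QVec n)) = S' := by
      have := congrArg (Submodule.map S'.subtype) b.toBasis.span_eq
      rw [Submodule.map_span, ← Set.range_comp, Submodule.map_top, Submodule.range_subtype] at this
      simpa [Function.comp_def] using this
    have h2 : (Set.range fun p => opVec.symm (b p : QVec n)) =
        (opVec (n := n)).symm.toLinearMap '' Set.range fun p => (b p : QVec n) := by
      rw [← Set.range_comp]
      rfl
    rw [h2, ← Submodule.map_span, h1, hS', ← Submodule.map_comp]
    simp

lemma IsTraceONB.mem {d : ℕ} {S : Submodule ℝ (QOp n)} {σ : Fin d → QOp n}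
    (h : IsTraceONB S σ) (p : Fin d) : σ p ∈ S := by
  rw [← h.2]
  exact Submodule.subset_span ⟨p, rfl⟩

lemma IsTraceONB.orthonormal {d : ℕ} {S : Submodule ℝ (QOp n)} {σ : Fin d → QOp n}
    (h : IsTraceONB S σ) (hS : ∀ B ∈ S, B.IsHermitian) : Orthonormal ℝ fun p => opVec (σ p) := by
  refine orthonormal_iff_ite.2 fun p q => ?_
  rw [(hS _ (h.mem p)).inner_opVec, trInner, h.1 p q]
  split_ifs <;> simp

/-- The training states are supported on a subspace of dimension at most `trainDim ρ xs`. -/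
lemma exists_support (hρ : ∀ x, IsPureState (ρ x)) (xs : Fin N → X) :
    ∃ (r : ℕ) (e : Fin r → EuclideanSpace ℂ (Fin (2 ^ n))), r ≤ trainDim ρ xs ∧
      Orthonormal ℂ e ∧ ∀ B ∈ trainSpan ρ xs,
        (∑ j, Matrix.vecMulVec (e j).ofLp (star (e j).ofLp)) * B = B := by
  -- A spanning family of size d picked from the training states themselves: its members still have
  -- rank one, so d vectors ψ span the joint support. A general basis of the span could have members
  -- of higher rank.
  obtain ⟨g, hg, hspan, -⟩ :=
    Submodule.exists_fun_fin_finrank_span_eq ℝ (Set.range fun i => ρ (xs i))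
  have hpure : ∀ i, IsPureState (g i) := fun i => by
    obtain ⟨j, hj⟩ := hg i
    rw [← hj]
    exact hρ _
  choose ψ hψ1 hψ2 using hpure
  set V : Submodule ℂ (EuclideanSpace ℂ (Fin (2 ^ n))) :=
    Submodule.span ℂ (Set.range fun i => WithLp.toLp 2 (ψ i)) with hV
  let b := stdOrthonormalBasis ℂ V
  refine ⟨Module.finrank ℂ V, fun j => b j, ?_, ?_, ?_⟩
  · refine (finrank_range_le_card _).trans ?_
    rw [Fintype.card_fin]
    exact le_rfl
  · exact b.orthonormal.comp_linearIsometry V.subtypeₗᵢ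
  · intro B hB
    rw [trainSpan, ← hspan] at hB
    refine Submodule.span_induction ?_ (Matrix.mul_zero _) ?_ ?_ hB
    · rintro _ ⟨i, rfl⟩
      rw [hψ2 i, Matrix.mul_vecMulVec]
      congr 1
      have hm : (WithLp.toLp 2 (ψ i) : EuclideanSpace ℂ (Fin (2 ^ n))) ∈ V :=
        Submodule.subset_span ⟨i, rfl⟩
      have h1 := congrArg (fun w : V => (w : EuclideanSpace ℂ (Fin (2 ^ n))).ofLp)
        (b.sum_repr' ⟨_, hm⟩)
      simp only [Submodule.coe_sum, Submodule.coe_smul, Submodule.coe_inner, WithLp.ofLp_sum,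
        WithLp.ofLp_smul] at h1
      rw [Matrix.sum_mulVec]
      refine Eq.trans ?_ h1
      refine Finset.sum_congr rfl fun j _ => ?_
      rw [Matrix.vecMulVec_mulVec, EuclideanSpace.inner_eq_star_dotProduct, dotProduct_comm]
      simp
    · intro A B _ _ hA hB
      rw [Matrix.mul_add, hA, hB]
    · intro a B _ hB
      rw [Matrix.mul_smul, hB]

/-- The Frobenius norm of `A` times a projection of rank `r`. -/
lemma frobSq_mul_projection_le (A : QOp n) {r : ℕ} {e : Fin r → EuclideanSpace ℂ (Fin (2 ^ n))}
    (he : Orthonormal ℂ e) :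
    frobSq (A * ∑ j, Matrix.vecMulVec (e j).ofLp (star (e j).ofLp)) ≤ r * specNorm A ^ 2 := by
  set P : QOp n := ∑ j, Matrix.vecMulVec (e j).ofLp (star (e j).ofLp) with hP
  have hPh : P.conjTranspose = P := by
    rw [hP, Matrix.conjTranspose_sum]
    simp [Matrix.conjTranspose_vecMulVec]
  have hPe : ∀ j, P.mulVec (e j).ofLp = (e j).ofLp := by
    intro j
    rw [hP, Matrix.sum_mulVec, Finset.sum_eq_single j]
    · have := orthonormal_iff_ite.1 he j j
      rw [EuclideanSpace.inner_eq_star_dotProduct, dotProduct_comm] at this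
      rw [Matrix.vecMulVec_mulVec, this]
      simp
    · intro k _ hk
      have := orthonormal_iff_ite.1 he k j
      rw [EuclideanSpace.inner_eq_star_dotProduct, dotProduct_comm, if_neg hk] at this
      rw [Matrix.vecMulVec_mulVec, this]
      simp
    · simp
  have hPP : P * P = P := by
    conv_lhs => rw [hP, Matrix.mul_sum]
    exact Finset.sum_congr rfl fun j _ => by rw [Matrix.mul_vecMulVec, ← hP, hPe]
  -- ‖AP‖² = Tr(P A†A P) = Tr(A†A P), by cyclicity and P² = P.
  have h1 : frobSq (A * P) = ∑ j, ‖(WithLp.toLp 2 (A.mulVec (e j).ofLp) :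
      EuclideanSpace ℂ (Fin (2 ^ n)))‖ ^ 2 := by
    rw [← norm_sq_opVec, ← real_inner_self_eq_norm_sq, inner_opVec, Matrix.conjTranspose_mul, hPh,
      Matrix.mul_assoc, Matrix.trace_mul_comm, Matrix.mul_assoc, Matrix.mul_assoc, hPP,
      ← Matrix.mul_assoc, hP, Matrix.mul_sum, Matrix.trace_sum, Complex.re_sum]
    refine Finset.sum_congr rfl fun j _ => ?_
    rw [trace_mul_vecMulVec_star, norm_toLp_sq_eq, Matrix.star_mulVec, ← Matrix.mulVec_mulVec,
      Matrix.dotProduct_mulVec]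
  rw [h1]
  calc _ ≤ ∑ _j : Fin r, specNorm A ^ 2 := by
        refine Finset.sum_le_sum fun j _ => ?_
        have := norm_toLp_mulVec_le A (e j).ofLp
        rw [WithLp.toLp_ofLp, he.1 j, mul_one] at this
        gcongr
    _ = _ := by simp

/-- On the span of the training states, `B ↦ Tr(A B)` is represented by a vector of squared norm
at most `trainDim ρ xs * specNorm A ^ 2`. -/
lemma exists_representer (hρ : ∀ x, IsPureState (ρ x)) (xs : Fin N → X) (A : QOp n) :
    ∃ G : QVec n, ‖G‖ ^ 2 ≤ trainDim ρ xs * specNorm A ^ 2 ∧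
      ∀ B ∈ trainSpan ρ xs, inner ℝ G (opVec B) = trInner A B := by
  obtain ⟨r, e, hr, he, hsupp⟩ := exists_support hρ xs
  set P : QOp n := ∑ j, Matrix.vecMulVec (e j).ofLp (star (e j).ofLp) with hP
  have hf : frobSq ((A * P).conjTranspose) = frobSq (A * P) := by
    rw [frobSq, Finset.sum_comm, frobSq]
    simp
  refine ⟨opVec (A * P).conjTranspose, ?_, fun B hB => ?_⟩
  · rw [norm_sq_opVec, hf]
    refine (frobSq_mul_projection_le A he).trans ?_
    gcongr
  · rw [inner_opVec, Matrix.conjTranspose_conjTranspose, Matrix.mul_assoc, hsupp B hB, trInner]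

/-- Bessel's inequality for any vector representing B ↦ Tr(AB) on the span. The representer
supported on the training states gives one bound, `A` itself the other. -/
lemma IsTraceONB.sum_trInner_sq_le (hρ : ∀ x, IsPureState (ρ x)) (xs : Fin N → X)
    {σ : Fin (trainDim ρ xs) → QOp n} (hσ : IsTraceONB (trainSpan ρ xs) σ) {A : QOp n}
    (hA : A.IsHermitian) :
    ∑ p, trInner A (σ p) ^ 2 ≤ min ((trainDim ρ xs : ℝ) * specNorm A ^ 2) (frobSq A) := by
  have hon := hσ.orthonormal fun B => isHermitian_of_mem_trainSpan hρ xs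
  have key : ∀ G : QVec n, (∀ B ∈ trainSpan ρ xs, inner ℝ G (opVec B) = trInner A B) →
      ∑ p, trInner A (σ p) ^ 2 ≤ ‖G‖ ^ 2 := by
    intro G hG
    refine le_trans (le_of_eq ?_) (hon.sum_inner_products_le G (s := Finset.univ))
    refine Finset.sum_congr rfl fun p _ => ?_
    rw [real_inner_comm, hG _ (hσ.mem p), Real.norm_eq_abs, sq_abs]
  obtain ⟨G, hG1, hG2⟩ := exists_representer hρ xs A
  refine le_min ((key G hG2).trans hG1) ?_
  rw [← norm_sq_opVec]
  exact key _ fun B _ => hA.inner_opVec B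

end TrainingSpan

/-! ### The quantum kernel model and its prediction error -/

section Model

variable {n N : ℕ} {X : Type*} {ρ : X → QOp n}

/-- The orthogonal projection of `A` to the span of the training states. -/
noncomputable def trainProj (ρ : X → QOp n) (A : QOp n) (xs : Fin N → X) : QVec n :=
  (Submodule.span ℝ (Set.range fun i => opVec (ρ (xs i)))).starProjection (opVec A)

lemma tendsto_regularizedModel (hρ : ∀ x, IsPureState (ρ x)) {A : QOp n} (hA : A.IsHermitian)
    (xs : Fin N → X) (x : X) :
    Tendsto (fun lam : ℝ => regularizedModel (quantumKernel ρ) xs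
        (fun i => trInner A (ρ (xs i))) lam x) (𝓝[>] 0)
      (𝓝 (clip (inner ℝ (trainProj ρ A xs) (opVec (ρ x))))) := by
  have h := (continuous_clip.tendsto _).comp
    (tendsto_ridge (fun i => opVec (ρ (xs i))) (opVec A) (opVec (ρ x)))
  simp only [hA.inner_opVec, (hρ _).isHermitian.inner_opVec] at h
  exact h

lemma quantumModel_eq (hρ : ∀ x, IsPureState (ρ x)) {A : QOp n} (hA : A.IsHermitian)
    (xs : Fin N → X) (x : X) :
    quantumModel ρ A xs x = clip (inner ℝ (trainProj ρ A xs) (opVec (ρ x))) :=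
  (tendsto_regularizedModel hρ hA xs x).limUnder_eq

lemma inner_trainProj (ρ : X → QOp n) (A : QOp n) (xs : Fin N → X) (i : Fin N) :
    inner ℝ (trainProj ρ A xs) (opVec (ρ (xs i))) = inner ℝ (opVec A) (opVec (ρ (xs i))) := by
  have h := (Submodule.span ℝ (Set.range fun i => opVec (ρ (xs i)))).starProjection_inner_eq_zero
    (opVec A) (opVec (ρ (xs i))) (Submodule.subset_span ⟨i, rfl⟩)
  rw [inner_sub_left, sub_eq_zero] at h
  exact h.symm

lemma norm_trainProj_le (ρ : X → QOp n) (A : QOp n) (xs : Fin N → X) :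
    ‖trainProj ρ A xs‖ ≤ ‖opVec A‖ :=
  Submodule.norm_starProjection_apply_le _ _

/-- The projection w is the shortest representer of the functional: any other representer G
satisfies ‖w‖² = ⟨A, w⟩ = ⟨G, w⟩ ≤ ‖G‖‖w‖. -/
lemma norm_sq_trainProj_le (hρ : ∀ x, IsPureState (ρ x)) {A : QOp n} (hA : A.IsHermitian)
    (xs : Fin N → X) : ‖trainProj ρ A xs‖ ^ 2 ≤ trainDim ρ xs * specNorm A ^ 2 := by
  obtain ⟨G, hG1, hG2⟩ := exists_representer hρ xs A
  refine le_trans ?_ hG1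
  set S := Submodule.span ℝ (Set.range fun i => opVec (ρ (xs i))) with hS
  have hmem : trainProj ρ A xs ∈ S := S.starProjection_apply_mem _
  have h1 := S.starProjection_inner_eq_zero (opVec A) _ hmem
  rw [inner_sub_left, sub_eq_zero] at h1
  have h2 : inner ℝ (opVec A) (trainProj ρ A xs) = ‖trainProj ρ A xs‖ ^ 2 := by
    rw [h1, ← real_inner_self_eq_norm_sq, trainProj]
  rw [hS, ← map_opVec_trainSpan] at hmem
  obtain ⟨B, hB, e⟩ := hmem
  rw [← e] at h2 ⊢
  have h3 : inner ℝ G (opVec B) = ‖opVec B‖ ^ 2 :=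
    (hG2 B hB).trans ((hA.inner_opVec B).symm.trans h2)
  have h4 := real_inner_le_norm G (opVec B)
  rw [h3] at h4
  refine pow_le_pow_left₀ (norm_nonneg _) ?_ 2
  change ‖opVec B‖ ≤ ‖G‖
  nlinarith [norm_nonneg (opVec B), norm_nonneg G]

lemma one_le_trainDim (hρ : ∀ x, IsPureState (ρ x)) (hN : 0 < N) (xs : Fin N → X) :
    1 ≤ trainDim ρ xs := by
  have hmem : ρ (xs ⟨0, hN⟩) ∈ trainSpan ρ xs := Submodule.subset_span ⟨_, rfl⟩
  refine Module.finrank_pos_iff_exists_ne_zero.2 ⟨⟨_, hmem⟩, fun h => ?_⟩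
  have h1 := (hρ (xs ⟨0, hN⟩)).norm_opVec
  have h2 : ρ (xs ⟨0, hN⟩) = 0 := congrArg Subtype.val h
  rw [h2, map_zero, norm_zero] at h1
  exact zero_ne_one h1

lemma measurable_inner_opVec [MeasurableSpace X] (hm : ∀ a b, Measurable fun x => ρ x a b)
    (w : QVec n) : Measurable fun x => inner ℝ w (opVec (ρ x)) := by
  simp only [PiLp.inner_apply, opVec_apply]
  exact Finset.measurable_sum _ fun p _ => measurable_const.inner (hm _ _)

lemma PredErrorLE.mono [MeasurableSpace X] {D : Measure X} {A : QOp n} {f : X → ℝ} {b c : ℝ}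
    (h : PredErrorLE D ρ A f b) (hbc : b ≤ c) : PredErrorLE D ρ A f c :=
  ⟨h.1, h.2.trans hbc⟩

variable [MeasurableSpace X] (D : Measure X) [IsProbabilityMeasure D]

/-- The prediction error is governed by that of an interpolating predictor for the observable
rescaled by `s`, where `s = 1` or the truncation is inactive. -/
lemma measure_not_predErrorLE_le_of_scale (hρ : ∀ x, IsPureState (ρ x))
    (hm : ∀ a b, Measurable fun x => ρ x a b) {A : QOp n} (hA : A.IsHermitian) (hN : 0 < N)
    {δ : ℝ} (hδ : 0 < δ) (hδ1 : δ < 1) {s : ℝ} (hs : 0 < s)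
    (hs1 : s = 1 ∨ ‖opVec A‖ ≤ s ∧ s ≤ 1) (hb : ∀ x, |trInner A (ρ x)| ≤ s)
    (k : (Fin N → X) → ℕ) (hk : ∀ xs, 0 < k xs)
    (hkw : ∀ xs, ‖trainProj ρ A xs‖ ^ 2 ≤ s ^ 2 * k xs) :
    (Measure.pi fun _ : Fin N => D) {xs | ¬ PredErrorLE D ρ A (quantumModel ρ A xs)
        (s * (8 * (√(k xs / N) + √(Real.log (1 / δ) / N))))} ≤ ENNReal.ofReal δ := by
  set v : X → QVec n := fun x => opVec (ρ x)
  set f : X → ℝ := fun x => inner ℝ (s⁻¹ • opVec A) (v x)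
  have hfA : ∀ x, trInner A (ρ x) = s * f x := fun x => by
    simp only [f, v]
    rw [real_inner_smul_left, hA.inner_opVec, mul_inv_cancel_left₀ hs.ne']
  have hv : ∀ x, ‖v x‖ ≤ 1 := fun x => (hρ x).norm_opVec.le
  have hvm : ∀ w : QVec n, Measurable fun x => inner ℝ w (v x) := measurable_inner_opVec hm
  have hf : ∀ x, |f x| ≤ 1 := fun x => by
    have h := hb x
    rw [hfA, abs_mul, abs_of_pos hs] at h
    exact le_of_mul_le_mul_left (by linarith) hs
  refine (measure_mono ?_).trans
    (measure_exists_interpolating_le D hv hvm (hvm _) hf hN hδ hδ1)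
  intro xs hxs
  by_contra hcon
  refine hxs ?_
  set w : QVec n := s⁻¹ • trainProj ρ A xs
  have hw : trainProj ρ A xs = s • w := by
    simp only [w]
    rw [smul_smul, mul_inv_cancel₀ hs.ne', one_smul]
  have hloss : ∀ x, |quantumModel ρ A xs x - trInner A (ρ x)| = s * clippedLoss v f w x := by
    intro x
    rw [quantumModel_eq hρ hA, hfA, hw, real_inner_smul_left, clippedLoss]
    -- Truncation does not commute with scaling. In the second case the norm bounds keep both
    -- arguments in [-1, 1], where it is the identity.
    rcases hs1 with rfl | ⟨h1, h2⟩
    · simp [v]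
    · have hwx : |inner ℝ w (v x)| ≤ 1 := by
        refine (abs_real_inner_le_norm _ _).trans (mul_le_one₀ ?_ (norm_nonneg _) (hv x))
        rw [norm_smul, norm_inv, Real.norm_of_nonneg hs.le, inv_mul_le_iff₀ hs, mul_one]
        exact (norm_trainProj_le ρ A xs).trans h1
      have hswx : |s * inner ℝ w (v x)| ≤ 1 := by
        rw [abs_mul, abs_of_pos hs]
        exact mul_le_one₀ h2 (abs_nonneg _) hwx
      rw [clip_of_abs_le hswx, clip_of_abs_le hwx, ← mul_sub, abs_mul, abs_of_pos hs]
  have hint : ∫ x, clippedLoss v f w x ∂D ≤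
      8 * (√(k xs / N) + √(Real.log (1 / δ) / N)) := by
    by_contra! h
    refine hcon ⟨w, k xs, hk xs, ?_, fun i => ?_, h⟩
    · have := hkw xs
      rw [hw, norm_smul, Real.norm_of_nonneg hs.le, mul_pow] at this
      exact le_of_mul_le_mul_left this (by positivity)
    · simp only [w, v]
      rw [real_inner_smul_left, real_inner_smul_left, inner_trainProj]
  simp only [PredErrorLE, hloss]
  refine ⟨(integrable_clippedLoss D hvm (hvm _) hf w).const_mul s, ?_⟩
  rw [integral_const_mul]
  exact mul_le_mul_of_nonneg_left hint hs.le

/-- Generalization of the quantum kernel model; the confidence term carries a factor that is small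
for observables of small Frobenius norm. -/
lemma measure_not_predErrorLE_le (hρ : ∀ x, IsPureState (ρ x))
    (hm : ∀ a b, Measurable fun x => ρ x a b) {A : QOp n} (hA : A.IsHermitian)
    (hA1 : specNorm A ≤ 1) (hN : 0 < N) {δ : ℝ} (hδ : 0 < δ) (hδ1 : δ < 1) :
    (Measure.pi fun _ : Fin N => D) {xs | ¬ PredErrorLE D ρ A (quantumModel ρ A xs)
        (16 * √(min (trainDim ρ xs : ℝ) (trInner A A) / N) +
          8 * √(min 1 (trInner A A)) * √(Real.log (1 / δ) / N))} ≤ ENNReal.ofReal δ := by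
  set τ := trInner A A with hτ
  have hτA : τ = ‖opVec A‖ ^ 2 := by
    rw [← real_inner_self_eq_norm_sq, hA.inner_opVec]
  have hd : ∀ xs : Fin N → X, (1 : ℝ) ≤ trainDim ρ xs := fun xs => by
    exact_mod_cast one_le_trainDim hρ hN xs
  -- For τ ≥ 1 no rescaling is needed, and rounding min(d, τ) ≥ 1 up to an integer costs at most the
  -- factor 2 on the root. For 0 < τ < 1 the scale is s = ‖A‖_F with k = 1, so both error terms
  -- carry √τ. The case A = 0 is separate because s must be positive.
  rcases le_or_gt 1 τ with h1 | h1
  · have hm1 : ∀ xs : Fin N → X, 1 ≤ min (trainDim ρ xs : ℝ) τ := fun xs => le_min (hd xs) h1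
    refine (measure_mono ?_).trans (measure_not_predErrorLE_le_of_scale D hρ hm hA hN hδ hδ1
      one_pos (.inl rfl) (fun x => ((hρ x).abs_trInner_le A).trans hA1)
      (fun xs => ⌈min (trainDim ρ xs : ℝ) τ⌉₊)
      (fun xs => Nat.ceil_pos.2 (by linarith [hm1 xs])) fun xs => ?_)
    · intro xs hxs h
      refine hxs (h.mono ?_)
      have h2 : √((⌈min (trainDim ρ xs : ℝ) τ⌉₊ : ℝ) / N) ≤
          2 * √(min (trainDim ρ xs : ℝ) τ / N) := by
        refine Real.sqrt_le_iff.2 ⟨by positivity, ?_⟩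
        rw [mul_pow, Real.sq_sqrt (div_nonneg (by linarith [hm1 xs]) (Nat.cast_nonneg _)),
          ← mul_div_assoc]
        gcongr
        linarith [Nat.ceil_lt_add_one (by linarith [hm1 xs] : 0 ≤ min (trainDim ρ xs : ℝ) τ),
          hm1 xs]
      rw [min_eq_left h1, Real.sqrt_one]
      linarith
    · rw [one_pow, one_mul]
      refine le_trans (le_min ?_ ?_) (Nat.le_ceil _)
      · refine (norm_sq_trainProj_le hρ hA xs).trans (mul_le_of_le_one_right (by positivity) ?_)
        exact pow_le_one₀ (norm_nonneg _) hA1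
      · rw [hτA]
        exact pow_le_pow_left₀ (norm_nonneg _) (norm_trainProj_le ρ A xs) 2
  · rcases (norm_nonneg (opVec A)).eq_or_lt with h0 | h0
    · have hA0 : A = 0 := by
        rw [eq_comm, norm_eq_zero, LinearEquiv.map_eq_zero_iff] at h0
        exact h0
      have hz : ∀ (xs : Fin N → X) (x : X), |quantumModel ρ A xs x - trInner A (ρ x)| = 0 := by
        intro xs x
        rw [quantumModel_eq hρ hA, trainProj, hA0]
        simp [trInner, clip]
      refine (measure_mono_null (fun xs hxs => ?_) measure_empty).trans_le (by positivity)
      refine hxs ?_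
      simp only [PredErrorLE, hz]
      exact ⟨integrable_zero _ _ _, by rw [integral_zero]; positivity⟩
    · have hs1 : ‖opVec A‖ ≤ 1 := by
        rw [hτA] at h1
        nlinarith
      refine (measure_mono ?_).trans (measure_not_predErrorLE_le_of_scale D hρ hm hA hN hδ hδ1
        h0 (.inr ⟨le_rfl, hs1⟩) (fun x => ?_) (fun _ => 1) (fun _ => one_pos) fun xs => ?_)
      · intro xs hxs h
        refine hxs (h.mono ?_)
        rw [min_eq_right h1.le, min_eq_right (h1.le.trans (hd xs)), hτA,
          Real.sqrt_div' _ (Nat.cast_nonneg N), Real.sqrt_div' _ (Nat.cast_nonneg N),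
          Real.sqrt_div' _ (Nat.cast_nonneg N), Real.sqrt_sq h0.le, Nat.cast_one, Real.sqrt_one]
        have : 0 ≤ ‖opVec A‖ / √(N : ℝ) := by positivity
        have e : ‖opVec A‖ * (1 / √(N : ℝ)) = ‖opVec A‖ / √(N : ℝ) := by ring
        linear_combination 8 * this + 8 * e
      · rw [← hA.inner_opVec]
        refine (abs_real_inner_le_norm _ _).trans ?_
        rw [(hρ x).norm_opVec, mul_one]
      · rw [Nat.cast_one, mul_one]
        exact pow_le_pow_left₀ (norm_nonneg _) (norm_trainProj_le ρ A xs) 2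

end Model

/-! ### Assembly of the theorem -/

theorem mainTheorem3 :
    ∃ C : ℝ, 0 < C ∧
      ∀ (n : ℕ) (X : Type*) [MeasurableSpace X] (D : Measure X) [IsProbabilityMeasure D]
        (ρ : X → QOp n) (O : QOp n) (U : Matrix.unitaryGroup (Fin (2 ^ n)) ℂ) (N : ℕ),
        (∀ x, IsPureState (ρ x)) →
        (∀ a b, Measurable fun x => ρ x a b) →
        O.IsHermitian →
        0 < N →
        -- the squared Frobenius norm of `O^U` restricted to the span of the training states
        (∀ xs : Fin N → X,
          (∃ σ : Fin (trainDim ρ xs) → QOp n, IsTraceONB (trainSpan ρ xs) σ) ∧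
          ∀ σ : Fin (trainDim ρ xs) → QOp n, IsTraceONB (trainSpan ρ xs) σ →
            ∑ p, trInner (heisenberg U O) (σ p) ^ 2 ≤
              min ((trainDim ρ xs : ℝ) * specNorm O ^ 2) (frobSq (heisenberg U O))) ∧
        (specNorm O ≤ 1 →
          -- the limit that defines the trained model exists
          (∀ (xs : Fin N → X) (x : X),
            Tendsto (fun lam : ℝ => regularizedModel (quantumKernel ρ) xs
                (fun i => trInner (heisenberg U O) (ρ (xs i))) lam x)
              (𝓝[>] 0) (𝓝 (quantumModel ρ (heisenberg U O) xs x))) ∧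
          -- with probability at least `1 - δ` over the training inputs
          (∀ δ : ℝ, 0 < δ → δ < 1 →
            (Measure.pi fun _ : Fin N => D) {xs | ¬ PredErrorLE D ρ (heisenberg U O)
                (quantumModel ρ (heisenberg U O) xs)
                (C * (√(min (trainDim ρ xs : ℝ) (trInner O O) / N)
                  + √(Real.log (1 / δ) / N)))}
              ≤ ENNReal.ofReal δ) ∧
          -- with probability at least `0.99`, without the confidence term
          (Measure.pi fun _ : Fin N => D) {xs | ¬ PredErrorLE D ρ (heisenberg U O)
              (quantumModel ρ (heisenberg U O) xs)
              (C * √(min (trainDim ρ xs : ℝ) (trInner O O) / N))}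
            ≤ ENNReal.ofReal (1 / 100)) := by
  -- 40 = 16 + 8·3, where 3 bounds √(log 100); only the statement at fixed confidence needs it all.
  refine ⟨40, by norm_num, ?_⟩
  intro n X _ D _ ρ O U N hρ hm hO hN
  have hA := heisenberg_isHermitian hO U
  have hspec := specNorm_heisenberg_le U O
  refine ⟨fun xs => ⟨exists_isTraceONB hρ xs, fun σ hσ => ?_⟩, fun hO1 => ⟨fun xs x => ?_, ?_, ?_⟩⟩
  · refine (hσ.sum_trInner_sq_le hρ xs hA).trans (min_le_min_right _ ?_)
    have : 0 ≤ specNorm (heisenberg U O) := norm_nonneg _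
    gcongr
  · rw [quantumModel_eq hρ hA]
    exact tendsto_regularizedModel hρ hA xs x
  · intro δ hδ hδ1
    refine (measure_mono ?_).trans
      (measure_not_predErrorLE_le D hρ hm hA (hspec.trans hO1) hN hδ hδ1)
    intro xs hxs h
    refine hxs (h.mono ?_)
    rw [trInner_heisenberg_self]
    have h1 : √(min 1 (trInner O O)) ≤ 1 := Real.sqrt_le_one.2 (min_le_left _ _)
    have h2 := mul_le_mul_of_nonneg_right h1 (Real.sqrt_nonneg (Real.log (1 / δ) / N))
    have h3 := Real.sqrt_nonneg (min (trainDim ρ xs : ℝ) (trInner O O) / N)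
    have h4 := Real.sqrt_nonneg (Real.log (1 / δ) / N)
    linarith
  · refine (measure_mono ?_).trans (measure_not_predErrorLE_le D hρ hm hA (hspec.trans hO1) hN
      (δ := 1 / 100) (by norm_num) (by norm_num))
    intro xs hxs h
    refine hxs (h.mono ?_)
    rw [trInner_heisenberg_self]
    have hd : (1 : ℝ) ≤ trainDim ρ xs := by exact_mod_cast one_le_trainDim hρ hN xs
    -- The factor √(min(1, Tr(O²))) and d ≥ 1 let the confidence term be absorbed even when Tr(O²)
    -- is tiny.
    have h1 : √(min 1 (trInner O O)) * √(Real.log (1 / (1 / 100)) / N) ≤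
        √(min (trainDim ρ xs : ℝ) (trInner O O) / N) * 3 := by
      have hlog : Real.log (1 / (1 / 100)) ≤ 9 := by
        have : Real.log (1 / (1 / 100)) ≤ Real.log (2 ^ 7) := Real.log_le_log (by norm_num) (by norm_num)
        rw [Real.log_pow] at this
        have := Real.log_two_lt_d9
        push_cast at *
        linarith
      have h9 : √(9 : ℝ) = 3 := by
        rw [show (9 : ℝ) = 3 ^ 2 by norm_num, Real.sqrt_sq (by norm_num)]
      rw [Real.sqrt_div' _ (Nat.cast_nonneg N), Real.sqrt_div' _ (Nat.cast_nonneg N), ← h9,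
        mul_div_assoc', div_mul_eq_mul_div]
      gcongr
    linarith
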